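/- Let $n$ be a nonnegative integer, $s\ge 1$ an integer and $k=2s+1$. Let $\Gamma_k=(V,L)$ be the Cayley tree of order $k$ (the tree in which every vertex has exactly $k+1$ edges) with root $x^0$, let $V_m$ and $W_m$ be the sets of vertices at distance at most $m$, respectively exactly $m$, from $x^0$, and let $J\neq 0$, $\beta>0$ and $-4^{\frac1{2n+1}}<\theta<4^{\frac1{2n+1}}$. Consider the model on $\Gamma_k$ with spin values in $[0,1]$ and formal Hamiltonian $$H(\sigma)=-J\sum_{\langle x,y\rangle\in L}\xi_{\sigma(x),\sigma(y)},\qquad \xi_{t,u}=\frac1{J\beta}\ln\Bigl(1+\theta\sqrt[2n+1]{(t-\tfrac12)(u-\tfrac12)}\Bigr),$$ where the odd root is the real one. Given measurable functions $t\mapsto h_{t,x}$ on $[0,1]$, $x\in V\setminus\{x^0\}$, let $\mu^{(m)}$, $m\ge1$, be the probability distribution on $[0,1]^{V_m}$ with density $$\mu^{(m)}(\sigma)=Z_m^{-1}\exp\Bigl(-\beta H(\sigma)+\sum_{x\in W_m}h_{\sigma(x),x}\Bigr)$$ with respect to the product of Lebesgue measures, where $H(\sigma)$ is the sum over the edges inside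 $V_m$ and $Z_m<\infty$ is the normalizing constant. If these distributions are compatible, that is, if $\int\mu^{(m+1)}(\sigma\vee\omega)\,d\omega=\mu^{(m)}(\sigma)$ for all $m\ge 1$ and $\sigma\in[0,1]^{V_m}$, with $\omega$ running over $[0,1]^{W_{m+1}}$, then the probability measure $\mu$ on $[0,1]^V$ with marginals $\mu^{(m)}$ is called a (splitting) Gibbs measure of the model. It is translation-invariant if it is invariant under the automorphisms of the tree. Put $$\alpha_{2i}=\frac{2n+1}{2n+2i+1}\Bigl(\frac12\Bigr)^{\frac{2i}{2n+1}},\qquad \beta_{2i+1}=\binom{2s+1}{2i+1}\alpha_{2i+2},\qquad \theta_{2i+1}=\frac{(2i+1)(2n+2i+3)\,4^{\frac1{2n+1}}}{(2s-2i+1)(2n+2i+1)},$$ $$\bar\theta=\frac{\sum_{i=1}^{s+1}2^{\frac{2i-2}{2n+1}}\beta_{2i-1}\theta_{2i-1}}{\sum_{i=1}^{s+1}2^{\frac{2i-2}{2n+1}}\beta_{2i-1}}.$$ Theorem 3.10. For $\theta$ with $-4^{\frac1{2n+1}}<\theta<4^{\frac1{2n+1}}$ the following hold. (a) If $-4^{\frac1{2n+1}}<\theta\le\theta_1$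 or $\theta_{2s+1}\le\theta<4^{\frac1{2n+1}}$, then the model has exactly one translation-invariant Gibbs measure. (b) If $\bar\theta\le\theta<\theta_{2s+1}$, then the model has exactly two translation-invariant Gibbs measures. (c) If $\theta_1<\theta<\bar\theta$, then the model has exactly three translation-invariant Gibbs measures. -/

import Mathlib

open MeasureTheory
open scoped ENNReal

noncomputable section

/-- The set `[0,1]` of spin values. -/
abbrev Spin : Type := unitInterval

/-- A Cayley tree (Bethe lattice) of order `k` with vertex set `V`: a tree in which every vertex is
incident to exactly `k + 1` edges. For `k ≥ 1` such a tree is automatically infinite. -/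
structure CayleyTree (k : ℕ) (V : Type*) where
  /-- the nearest-neighbour graph -/
  graph : SimpleGraph V
  isTree : graph.IsTree
  ncard_neighborSet : ∀ x, (graph.neighborSet x).ncard = k + 1

namespace CayleyTree

variable {k : ℕ} {V : Type*} (T : CayleyTree k V) (x₀ : V)

/-- `V_m`, the vertices at distance at most `m` from the root `x₀`. -/
def ball (m : ℕ) : Set V := {x | T.graph.dist x₀ x ≤ m}

/-- `W_m`, the vertices at distance exactly `m` from the root `x₀`. -/
def sphere (m : ℕ) : Set V := {x | T.graph.dist x₀ x = m}

theorem sphere_subset_ball (m : ℕ) : T.sphere x₀ m ⊆ T.ball x₀ m := fun _ hx => le_of_eq hx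

theorem ball_finite (m : ℕ) : (T.ball x₀ m).Finite := by
  induction m with
  | zero =>
    refine (Set.finite_singleton x₀).subset fun x hx => ?_
    have h0 : T.graph.dist x₀ x = 0 := Nat.le_zero.mp hx
    exact ((T.isTree.connected.dist_eq_zero_iff).mp h0).symm
  | succ m ih =>
    have hfin : ∀ y, (T.graph.neighborSet y).Finite := fun y =>
      Set.finite_of_ncard_ne_zero (by rw [T.ncard_neighborSet]; omega)
    refine (ih.union (ih.biUnion fun y _ => hfin y)).subset fun x hx => ?_
    obtain ⟨p, hp⟩ := T.isTree.connected.exists_walk_length_eq_dist x x₀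
    have hx' : T.graph.dist x₀ x ≤ m + 1 := hx
    rw [SimpleGraph.dist_comm, ← hp] at hx'
    cases p with
    | nil => exact Or.inl (by simp [ball])
    | @cons _ y _ h q =>
      refine Or.inr (Set.mem_biUnion (x := y) ?_ h.symm)
      have hq := SimpleGraph.dist_le q
      rw [SimpleGraph.dist_comm] at hq
      simp only [SimpleGraph.Walk.length_cons] at hx'
      exact hq.trans (by omega)

instance ballFintype (m : ℕ) : Fintype (T.ball x₀ m) := (T.ball_finite x₀ m).fintype

instance sphereFintype (m : ℕ) : Fintype (T.sphere x₀ m) :=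
  ((T.ball_finite x₀ m).subset (T.sphere_subset_ball x₀ m)).fintype

/-- The energy `H(σ) = -J ∑_{⟨x,y⟩} ξ_{σ(x),σ(y)}` of a configuration `σ` on the ball `V_m`; the sum
is over the (unordered) edges of the tree with both ends in `V_m`. The interaction `ξ` is symmetric,
so that it can be evaluated on unordered edges. -/
def hamiltonian (J : ℝ) (ξ : {ξ : Spin → Spin → ℝ // ∀ t u, ξ t u = ξ u t}) (m : ℕ)
    (σ : T.ball x₀ m → Spin) : ℝ :=
  -J * ∑ᶠ e ∈ (T.graph.induce (T.ball x₀ m)).edgeSet, Sym2.lift ξ (e.map σ)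

/-- The unnormalised density `exp (-β H(σ) + ∑_{x ∈ W_m} h_{σ(x),x})` on configurations on `V_m`. -/
def weight (J β : ℝ) (ξ : {ξ : Spin → Spin → ℝ // ∀ t u, ξ t u = ξ u t}) (h : V → Spin → ℝ) (m : ℕ)
    (σ : T.ball x₀ m → Spin) : ℝ≥0∞ :=
  ENNReal.ofReal (Real.exp (-β * T.hamiltonian x₀ J ξ m σ +
    ∑ x : T.sphere x₀ m, h x (σ ⟨x, T.sphere_subset_ball x₀ m x.2⟩)))

/-- The partition function `Z_m`; the reference measure is the product of Lebesgue measures. -/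
def partitionFunction (J β : ℝ) (ξ : {ξ : Spin → Spin → ℝ // ∀ t u, ξ t u = ξ u t})
    (h : V → Spin → ℝ) (m : ℕ) : ℝ≥0∞ :=
  ∫⁻ σ : T.ball x₀ m → Spin, T.weight x₀ J β ξ h m σ

/-- The density `μ^{(m)}(σ)` with respect to the product of Lebesgue measures on `[0,1]^{V_m}`. -/
def density (J β : ℝ) (ξ : {ξ : Spin → Spin → ℝ // ∀ t u, ξ t u = ξ u t}) (h : V → Spin → ℝ) (m : ℕ)
    (σ : T.ball x₀ m → Spin) : ℝ≥0∞ :=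
  (T.partitionFunction x₀ J β ξ h m)⁻¹ * T.weight x₀ J β ξ h m σ

/-- The concatenation `σ ∨ ω` on `V_{m+1}` of `σ` on `V_m` and `ω` on `W_{m+1}`. -/
def concat (m : ℕ) (σ : T.ball x₀ m → Spin) (ω : T.sphere x₀ (m + 1) → Spin) :
    T.ball x₀ (m + 1) → Spin := fun x =>
  if hx : T.graph.dist x₀ (x : V) ≤ m then σ ⟨x, hx⟩
  else ω ⟨x, le_antisymm x.2 (Nat.lt_of_not_le hx)⟩

/-- `μ` is the splitting Gibbs measure on `[0,1]^V` corresponding to the Hamiltonian with coupling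
`J` and interaction `ξ`, at inverse temperature `β`, and to the family of functions `h_x`, `x ≠ x₀`:
the distributions `μ^{(m)}`, `m = 1, 2, …`, are well defined and compatible, and they are the
marginals of `μ` on the balls `V_m`. The value of `h` at the root is never used. -/
structure IsSplittingGibbsFor (J β : ℝ) (ξ : {ξ : Spin → Spin → ℝ // ∀ t u, ξ t u = ξ u t})
    (h : V → Spin → ℝ) (μ : Measure (V → Spin)) : Prop where
  measurable : ∀ x, x ≠ x₀ → Measurable (h x)
  partitionFunction_ne_top : ∀ m, 1 ≤ m → T.partitionFunction x₀ J β ξ h m ≠ ∞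
  compatible : ∀ m, 1 ≤ m → ∀ σ : T.ball x₀ m → Spin,
    ∫⁻ ω : T.sphere x₀ (m + 1) → Spin, T.density x₀ J β ξ h (m + 1) (T.concat x₀ m σ ω) =
      T.density x₀ J β ξ h m σ
  marginal : ∀ m, 1 ≤ m →
    μ.map (fun (σ : V → Spin) (x : T.ball x₀ m) => σ x) =
      (volume : Measure (T.ball x₀ m → Spin)).withDensity (T.density x₀ J β ξ h m)

/-- A measure on `[0,1]^V` is translation invariant if it is invariant under the automorphisms of
the tree. -/
def IsTranslationInvariant (μ : Measure (V → Spin)) : Prop :=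
  ∀ φ : T.graph ≃g T.graph, μ.map (fun (σ : V → Spin) (x : V) => σ (φ x)) = μ

/-- The set of translation-invariant (splitting) Gibbs measures of the model. -/
def translationInvariantGibbs (J β : ℝ) (ξ : {ξ : Spin → Spin → ℝ // ∀ t u, ξ t u = ξ u t}) :
    Set (Measure (V → Spin)) :=
  {μ | IsProbabilityMeasure μ ∧ (∃ h : V → Spin → ℝ, T.IsSplittingGibbsFor x₀ J β ξ h μ) ∧
    T.IsTranslationInvariant μ}

end CayleyTree

/-- The real root of odd order `2n+1` of a real number of either sign. -/
def oddRoot (n : ℕ) (x : ℝ) : ℝ := Real.sign x * |x| ^ (1 / (2 * n + 1) : ℝ)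

/-- The interaction
`ξ_{t,u} = (1 / (J β)) ln (1 + θ ((t - 1/2) (u - 1/2))^{1/(2n+1)})`, `t, u ∈ [0,1]`. -/
def interaction (n : ℕ) (J β θ : ℝ) : {ξ : Spin → Spin → ℝ // ∀ t u, ξ t u = ξ u t} :=
  ⟨fun t u => 1 / (J * β) * Real.log (1 + θ * oddRoot n (((t : ℝ) - 1 / 2) * ((u : ℝ) - 1 / 2))),
    fun t u => by simp only [mul_comm ((t : ℝ) - 1 / 2)]⟩

/-- `alphaEven n i` is `α_{2i} = (2n+1)/(2n+2i+1) · (1/2)^{2i/(2n+1)}`. -/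
def alphaEven (n i : ℕ) : ℝ :=
  (2 * n + 1) / (2 * n + 2 * i + 1) * (1 / 2 : ℝ) ^ (2 * i / (2 * n + 1) : ℝ)

/-- `betaOdd n s i` is `β_{2i+1} = C(2s+1, 2i+1) · α_{2i+2}`. -/
def betaOdd (n s i : ℕ) : ℝ := (Nat.choose (2 * s + 1) (2 * i + 1) : ℝ) * alphaEven n (i + 1)

/-- `thetaOdd n s i` is
`θ_{2i+1} = (2i+1)(2n+2i+3) 4^{1/(2n+1)} / ((2s-2i+1)(2n+2i+1))`, used for `0 ≤ i ≤ s`. -/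
def thetaOdd (n s i : ℕ) : ℝ :=
  (2 * i + 1) * (2 * n + 2 * i + 3) * (4 : ℝ) ^ (1 / (2 * n + 1) : ℝ) /
    ((2 * (s : ℝ) - 2 * i + 1) * (2 * n + 2 * i + 1))

/-- The weighted average
`(∑_{i=1}^{s+1} 2^{(2i-2)/(2n+1)} β_{2i-1} θ_{2i-1}) / (∑_{i=1}^{s+1} 2^{(2i-2)/(2n+1)} β_{2i-1})`,
with the summation index shifted by one. -/
def thetaAverage (n s : ℕ) : ℝ :=
  (∑ i ∈ Finset.range (s + 1),
      (2 : ℝ) ^ (2 * i / (2 * n + 1) : ℝ) * betaOdd n s i * thetaOdd n s i) /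
    ∑ i ∈ Finset.range (s + 1), (2 : ℝ) ^ (2 * i / (2 * n + 1) : ℝ) * betaOdd n s i

end

/-!
The odd root is multiplicative, so with `ρ t = (t - 1/2)^{1/(2n+1)}` the Boltzmann factor of an edge
is the rank-two kernel `1 + θ ρ(t) ρ(u)`, which is positive for the `θ` of the model. A message
`∫ (1 + θ ρ(s) ρ(u)) f(u) du` is therefore a multiple of `1 + θ c ρ(s)`, where `c` is the mean of
`ρ` under the density proportional to `f`. Translation-invariant Gibbs measures correspond
bijectively to the fixed points `c` of `c ∫ (1 + θ c ρ)^k = ∫ ρ (1 + θ c ρ)^k` with `1 + θ c ρ > 0`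
on `[0,1]` (`CayleyTree.ncard_translationInvariantGibbs`):

* The expectation under `μ` of `g(σ_x) / (1 + θ ρ(σ_p) ρ(σ_x))`, for a vertex `x` with parent `p`,
  is proportional to `∫ g exp h_x`, so the mean `c` of the message along an edge can be read off
  from `μ` (`CayleyTree.messageMean_mul_integral`). A regular tree is arc-transitive
  (`SimpleGraph.IsTree.exists_iso_of_adj`), hence translation invariance makes all these means
  equal; compatibility then turns the density on `V_m` into a multiple of
  `∏_{edges} (1 + θ ρ ρ) ∏_{x ∈ W_m} (1 + θ c ρ(σ_x))^k`. So `μ` is determined by `c`, and `c` is a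
  fixed point (`CayleyTree.messageMean_mem_fixedPoints`).
* Conversely a fixed point gives, for each finite connected set `S`, the density
  `∏_{edges in S} (1 + θ ρ ρ) ∏_{x ∈ S} (1 + θ c ρ(σ_x))^{number of neighbours outside S}`, up to a
  constant. Integrating out a leaf of `S` leaves the density of the rest, so these densities are
  consistent; compactness of the space of probability measures on `[0,1]^V` gives a measure with
  these marginals. The densities do not mention the root, so the measure is translation invariant.

By the moments `∫ ρ^{2i} = α_{2i}`, the fixed point equation with `y = θ c` reads
`c ∑_j y^{2j} β_{2j+1} (θ_{2j+1} - θ) = 0`. As `θ_{2j+1}` is strictly increasing in `j`, the sum has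
at most one positive zero in `z = y^2`; it exists and satisfies the positivity condition
`z < 4^{1/(2n+1)}` precisely when `θ_1 < θ < θ̄`. Fixed points other than `0` come in pairs `± c`,
so there is one or there are three. The range of `θ` in the case of two measures contains no `θ`
with `θ < 4^{1/(2n+1)}`, since `θ̄ ≥ 4^{1/(2n+1)}` (`four_rpow_le_thetaAverage`); similarly
`θ_{2s+1} > 4^{1/(2n+1)}`.
-/

/-! ### Rooted trees and their automorphisms -/

namespace SimpleGraph

variable {V : Type*} {G : SimpleGraph V}

/-- In a tree, a neighbour of `v` that is closer to `r` lies on the path from `v` to `r`, so there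
is only one. -/
theorem IsTree.eq_of_adj_of_dist_lt (hG : G.IsTree) {r v u w : V} (hu : G.Adj v u)
    (hw : G.Adj v w) (hru : G.dist r u < G.dist r v) (hrw : G.dist r w < G.dist r v) : u = w := by
  have key : ∀ x, G.Adj v x → G.dist r x < G.dist r v →
      ∃ q : G.Walk v r, q.IsPath ∧ q.snd = x := by
    intro x hx hlt
    obtain ⟨q, hq⟩ := hG.connected.exists_walk_length_eq_dist x r
    refine ⟨.cons hx q, Walk.isPath_of_length_eq_dist _ ?_, by simp⟩
    rw [Walk.length_cons, hq, dist_comm, dist_comm (u := v)]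
    rcases hG.dist_eq_dist_add_one_of_adj r hx with h | h <;> omega
  obtain ⟨q, hq, rfl⟩ := key u hu hru
  obtain ⟨q', hq', rfl⟩ := key w hw hrw
  rw [(hG.existsUnique_path v r).unique hq hq']

theorem IsTree.exists_adj_dist_add_one (hG : G.IsTree) {r v : V} (h : v ≠ r) :
    ∃ p, G.Adj v p ∧ G.dist r p + 1 = G.dist r v := by
  obtain ⟨q, hq⟩ := hG.connected.exists_walk_length_eq_dist v r
  cases q with
  | nil => exact absurd rfl h
  | @cons _ p _ hp q =>
    refine ⟨p, hp, ?_⟩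
    have h1 := dist_le q
    rw [Walk.length_cons, dist_comm] at hq
    rw [dist_comm] at h1
    rcases hG.dist_eq_dist_add_one_of_adj r hp with h | h <;> omega

open Classical in
/-- The parent of `v` in the tree `G` rooted at `r`: its neighbour that is closer to the root. The
root is given the parent `a`. -/
noncomputable def treeParent (G : SimpleGraph V) (r a v : V) : V :=
  if h : v ≠ r ∧ ∃ p, G.Adj v p ∧ G.dist r p + 1 = G.dist r v then h.2.choose else a

@[simp] theorem treeParent_root (r a : V) : G.treeParent r a r = a := by
  simp [treeParent]

theorem IsTree.treeParent_spec (hG : G.IsTree) {r a v : V} (h : v ≠ r) :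
    G.Adj v (G.treeParent r a v) ∧ G.dist r (G.treeParent r a v) + 1 = G.dist r v := by
  have h' : v ≠ r ∧ ∃ p, G.Adj v p ∧ G.dist r p + 1 = G.dist r v :=
    ⟨h, hG.exists_adj_dist_add_one h⟩
  rw [treeParent, dif_pos h']
  exact h'.2.choose_spec

theorem IsTree.adj_treeParent (hG : G.IsTree) {r a : V} (ha : G.Adj r a) (v : V) :
    G.Adj v (G.treeParent r a v) := by
  by_cases h : v = r
  · subst h; simpa
  · exact (hG.treeParent_spec h).1

theorem IsTree.eq_treeParent_iff (hG : G.IsTree) {r a v u : V} (h : v ≠ r) :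
    u = G.treeParent r a v ↔ G.Adj v u ∧ G.dist r u < G.dist r v := by
  have hs := hG.treeParent_spec (a := a) h
  constructor
  · rintro rfl
    exact ⟨hs.1, by omega⟩
  · rintro ⟨h1, h2⟩
    exact hG.eq_of_adj_of_dist_lt h1 hs.1 h2 (by omega)

/-- Two adjacent vertices of a rooted tree are parent and child. -/
theorem IsTree.adj_cases (hG : G.IsTree) (r a : V) {u v : V} (h : G.Adj u v) :
    (v ≠ r ∧ u = G.treeParent r a v ∧ G.dist r v = G.dist r u + 1) ∨
      (u ≠ r ∧ v = G.treeParent r a u ∧ G.dist r u = G.dist r v + 1) := by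
  rcases hG.dist_eq_dist_add_one_of_adj r h with h' | h'
  · have hne : u ≠ r := by
      rintro rfl
      simp at h'
    exact Or.inr ⟨hne, (hG.eq_treeParent_iff hne).2 ⟨h, by omega⟩, h'⟩
  · have hne : v ≠ r := by
      rintro rfl
      simp at h'
    exact Or.inl ⟨hne, (hG.eq_treeParent_iff hne).2 ⟨h.symm, by omega⟩, h'⟩

/-- Two finite sets of the same size are in bijection, with a prescribed value at one point. -/
theorem _root_.Set.exists_bijOn_of_ncard_eq {α : Type*} {A B : Set α} {a b : α} (hA : A.Finite)
    (hB : B.Finite) (h : A.ncard = B.ncard) (ha : a ∈ A) (hb : b ∈ B) :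
    ∃ f : α → α, Set.BijOn f A B ∧ f a = b := by
  classical
  have := hA.to_subtype
  have := hB.to_subtype
  obtain ⟨e⟩ : Nonempty (A ≃ B) := Finite.card_eq.1 h
  let e' : A ≃ B := e.trans (Equiv.swap (e ⟨a, ha⟩) ⟨b, hb⟩)
  refine ⟨fun x => if hx : x ∈ A then e' ⟨x, hx⟩ else x, ⟨?_, ?_, ?_⟩, ?_⟩
  · intro x hx
    simp only [hx, dif_pos]
    exact (e' ⟨x, hx⟩).2
  · intro x hx y hy hxy
    simp only [hx, hy, dif_pos] at hxy
    simpa using e'.injective (Subtype.ext hxy)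
  · intro y hy
    refine ⟨e'.symm ⟨y, hy⟩, (e'.symm ⟨y, hy⟩).2, ?_⟩
    simp
  · simp [ha, e']

section Automorphism

variable (G) in
/-- One step in the construction of the map of rooted trees that follows the local bijections
`E u b u' b'` from the neighbours of `u` to those of `u'`. A pair holds the image of a vertex and
the image of its parent; it is extended from the parent of `v` to `v`. -/
noncomputable def childImage (r a : V) (E : V → V → V → V → V → V) (v : V) (z : V × V) : V × V :=
  (E (G.treeParent r a v) (G.treeParent r a (G.treeParent r a v)) z.1 z.2 v, z.1)

variable (G) in
/-- The images of the vertices at distance `n` from the root, and of their parents. -/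
noncomputable def levelImage (r a r' a' : V) (E : V → V → V → V → V → V) : ℕ → V → V × V
  | 0, _ => (r', a')
  | n + 1, v => G.childImage r a E v (levelImage r a r' a' E n (G.treeParent r a v))

/-- A regular tree is arc-transitive: the automorphism is built outwards from the root `r`, and it
is a bijection because it is one on the neighbours of each vertex. -/
theorem IsTree.exists_iso_of_adj (hG : G.IsTree) {d : ℕ} (hd : d ≠ 0)
    (hdeg : ∀ x, (G.neighborSet x).ncard = d) {r a r' a' : V} (h : G.Adj r a)
    (h' : G.Adj r' a') : ∃ φ : G ≃g G, φ r = r' ∧ φ a = a' := by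
  classical
  have hfin : ∀ x, (G.neighborSet x).Finite := fun x =>
    Set.finite_of_ncard_ne_zero (by rw [hdeg]; exact hd)
  have hE : ∀ u b u' b', ∃ f : V → V, G.Adj u b → G.Adj u' b' →
      Set.BijOn f (G.neighborSet u) (G.neighborSet u') ∧ f b = b' := by
    intro u b u' b'
    by_cases hub : G.Adj u b
    · by_cases hub' : G.Adj u' b'
      · obtain ⟨f, hf⟩ := Set.exists_bijOn_of_ncard_eq (hfin u) (hfin u')
          ((hdeg u).trans (hdeg u').symm) hub hub'
        exact ⟨f, fun _ _ => hf⟩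
      · exact ⟨id, fun _ h => absurd h hub'⟩
    · exact ⟨id, fun h => absurd h hub⟩
  choose E hE using hE
  let Φ : V → V × V := fun v => G.levelImage r a r' a' E (G.dist r v) v
  let par := G.treeParent r a
  have hpar : ∀ v, G.Adj v (par v) := hG.adj_treeParent h
  have hΦr : Φ r = (r', a') := by simp [Φ, levelImage]
  have hΦ : ∀ v, v ≠ r → Φ v = (E (par v) (par (par v)) (Φ (par v)).1 (Φ (par v)).2 v,
      (Φ (par v)).1) := by
    intro v hv
    have hs := (hG.treeParent_spec (a := a) hv).2
    simp only [Φ]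
    rw [← hs, levelImage]
    rfl
  have hadj : ∀ n v, G.dist r v = n → G.Adj (Φ v).1 (Φ v).2 := by
    intro n
    induction n with
    | zero =>
      intro v hv
      obtain rfl : r = v := (hG.connected.dist_eq_zero_iff).1 hv
      rw [hΦr]; exact h'
    | succ n ih =>
      intro v hv
      have hne : v ≠ r := by rintro rfl; simp at hv
      have hs := (hG.treeParent_spec (a := a) hne).2
      have := (hE _ _ _ _ (hpar (par v)) (ih (par v) (by simp only [par]; omega))).1.mapsTo
        (hpar v).symm
      rw [hΦ v hne]
      exact this.symm
  let e : V → V → V := fun u => E u (par u) (Φ u).1 (Φ u).2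
  have he : ∀ u, Set.BijOn (e u) (G.neighborSet u) (G.neighborSet (Φ u).1) ∧
      e u (par u) = (Φ u).2 := fun u => hE _ _ _ _ (hpar u) (hadj _ u rfl)
  have hΦ2 : ∀ v, v ≠ r → (Φ v).2 = (Φ (par v)).1 := fun v hv => by rw [hΦ v hv]
  let φ : V → V := fun v => (Φ v).1
  have hφe : ∀ u v, G.Adj u v → φ v = e u v := by
    intro u v huv
    rcases hG.adj_cases r a huv with ⟨hv, rfl, -⟩ | ⟨hu, rfl, -⟩
    · simp only [φ]
      rw [hΦ v hv]
    · have := (he u).2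
      rw [hΦ2 u hu] at this
      exact this.symm
  have hφadj : ∀ u v, G.Adj u v → G.Adj (φ u) (φ v) := by
    intro u v huv
    rw [hφe u v huv]
    exact (he u).1.mapsTo huv
  -- children are mapped to children, since the parent is already mapped to the parent
  have hdist : ∀ n v, G.dist r v = n →
      G.dist r' (φ v) = n ∧ (v ≠ r → φ (par v) = G.treeParent r' a' (φ v)) := by
    intro n
    induction n with
    | zero =>
      intro v hv
      obtain rfl : r = v := (hG.connected.dist_eq_zero_iff).1 hv
      simp [φ, hΦr]
    | succ n ih =>
      intro v hv
      have hne : v ≠ r := by rintro rfl; simp at hv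
      have hs := (hG.treeParent_spec (a := a) hne).2
      obtain ⟨ih1, ih2⟩ := ih (par v) (by simp only [par]; omega)
      have hch : φ (par v) = G.treeParent r' a' (φ v) ∧
          G.dist r' (φ v) = G.dist r' (φ (par v)) + 1 := by
        rcases hG.adj_cases r' a' (hφadj _ _ (hpar v).symm) with ⟨-, h1, h2⟩ | ⟨h0, h1, -⟩
        · exact ⟨h1, h2⟩
        · exfalso
          have hu : par v ≠ r := by
            intro hu
            rw [hu] at h0
            simp [φ, hΦr] at h0
          rw [← ih2 hu, hφe _ _ (hpar v).symm, hφe _ _ (hpar (par v))] at h1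
          have := (he (par v)).1.injOn (hpar v).symm (hpar (par v)) h1
          have h3 := (hG.treeParent_spec (a := a) hu).2
          have h4 : G.dist r (par (par v)) = n + 1 := by rw [← this]; exact hv
          simp only [par] at h3 h4
          omega
      exact ⟨by rw [hch.2, ih1], fun _ => hch.1⟩
  have hinj : ∀ n v w, G.dist r v = n → φ v = φ w → v = w := by
    intro n
    induction n with
    | zero =>
      intro v w hv hvw
      have h1 := (hdist 0 v hv).1
      rw [hvw, (hdist _ w rfl).1] at h1
      rw [← (hG.connected.dist_eq_zero_iff).1 hv, ← (hG.connected.dist_eq_zero_iff).1 h1]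
    | succ n ih =>
      intro v w hv hvw
      have h1 := (hdist _ v hv).1
      rw [hvw, (hdist _ w rfl).1] at h1
      have hne : v ≠ r := by rintro rfl; simp at hv
      have hne' : w ≠ r := by rintro rfl; simp at h1
      have hs := (hG.treeParent_spec (a := a) hne).2
      have hp : par v = par w := by
        refine ih _ _ (by simp only [par]; omega) ?_
        rw [(hdist _ v rfl).2 hne, (hdist _ w rfl).2 hne', hvw]
      rw [hφe _ _ (hpar v).symm, hφe _ _ (hpar w).symm, ← hp] at hvw
      exact (he (par v)).1.injOn (hpar v).symm (by rw [hp]; exact (hpar w).symm) hvw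
  have hsurj : ∀ n y, G.dist r' y = n → ∃ v, φ v = y := by
    intro n
    induction n with
    | zero =>
      intro y hy
      exact ⟨r, by simpa [φ, hΦr] using (hG.connected.dist_eq_zero_iff).1 hy⟩
    | succ n ih =>
      intro y hy
      have hne : y ≠ r' := by rintro rfl; simp at hy
      obtain ⟨h1, h2⟩ := hG.treeParent_spec (a := a') hne
      obtain ⟨u, hu⟩ := ih (G.treeParent r' a' y) (by omega)
      have : y ∈ G.neighborSet (φ u) := by rw [hu]; exact h1.symm
      obtain ⟨v, hv, hvy⟩ := (he u).1.surjOn this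
      exact ⟨v, by rw [hφe u v hv, hvy]⟩
  have hinj' : Function.Injective φ := fun v w => hinj _ v w rfl
  refine ⟨⟨Equiv.ofBijective φ ⟨hinj', fun y => hsurj _ y rfl⟩, ?_⟩, ?_, ?_⟩
  · intro u v
    refine ⟨fun huv => ?_, hφadj u v⟩
    have : φ v ∈ G.neighborSet (φ u) := huv
    obtain ⟨w, hw, hwv⟩ := (he u).1.surjOn this
    rw [← hφe u w hw] at hwv
    rwa [← hinj' hwv]
  · exact congrArg Prod.fst hΦr
  · change φ a = a'
    rw [hφe r a h]
    have := (he r).2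
    rw [hΦr] at this
    simpa [par] using this

end Automorphism

/-! ### Connected sets of vertices -/

/-- Any two vertices of `S` are joined by a walk inside `S`. -/
def WalkConnectedOn (G : SimpleGraph V) (S : Set V) : Prop :=
  ∀ u ∈ S, ∀ v ∈ S, ∃ w : G.Walk u v, ∀ x ∈ w.support, x ∈ S

theorem walkConnectedOn_singleton (v : V) : G.WalkConnectedOn {v} := by
  rintro u rfl w rfl
  exact ⟨.nil, by simp⟩

theorem WalkConnectedOn.insert {S : Set V} (hS : G.WalkConnectedOn S) {p y : V} (hp : p ∈ S)
    (h : G.Adj p y) : G.WalkConnectedOn (insert y S) := by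
  have key : ∀ u ∈ S, ∃ w : G.Walk u y, ∀ x ∈ w.support, x ∈ Insert.insert y S := by
    intro u hu
    obtain ⟨w, hw⟩ := hS u hu p hp
    refine ⟨w.concat h, fun x hx => ?_⟩
    rw [Walk.support_concat] at hx
    simp only [List.mem_append, List.mem_singleton] at hx
    rcases hx with hx | rfl
    · exact Or.inr (hw x hx)
    · exact Or.inl rfl
  intro u hu v hv
  rcases hu with rfl | hu <;> rcases hv with rfl | hv
  · exact ⟨.nil, by simp⟩
  · obtain ⟨w, hw⟩ := key v hv
    exact ⟨w.reverse, fun x hx => hw x (by simpa using hx)⟩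
  · exact key u hu
  · obtain ⟨w, hw⟩ := hS u hu v hv
    exact ⟨w, fun x hx => Or.inr (hw x hx)⟩

theorem WalkConnectedOn.image {S : Set V} (hS : G.WalkConnectedOn S) (φ : G →g G) :
    G.WalkConnectedOn (φ '' S) := by
  rintro _ ⟨u, hu, rfl⟩ _ ⟨v, hv, rfl⟩
  obtain ⟨w, hw⟩ := hS u hu v hv
  refine ⟨w.map φ, fun x hx => ?_⟩
  rw [Walk.support_map, List.mem_map] at hx
  obtain ⟨x, hx, rfl⟩ := hx
  exact ⟨x, hw x hx, rfl⟩

/-- In a tree, a vertex outside a connected set has at most one neighbour in that set. -/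
theorem IsTree.eq_of_adj_of_walkConnectedOn (hG : G.IsTree) {S : Set V}
    (hS : G.WalkConnectedOn S) {y p p' : V} (hy : y ∉ S) (hp : p ∈ S) (hp' : p' ∈ S)
    (h : G.Adj y p) (h' : G.Adj y p') : p = p' := by
  classical
  obtain ⟨w, hw⟩ := hS p hp p' hp'
  have h1 : (Walk.cons h w.bypass).IsPath := by
    rw [Walk.cons_isPath_iff]
    exact ⟨w.bypass_isPath, fun hmem => hy (hw y (w.support_bypass_subset_support hmem))⟩
  have h2 : (Walk.cons h' Walk.nil).IsPath := by
    simpa using h'.ne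
  have := (hG.existsUnique_path y p').unique h1 h2
  simpa using congrArg Walk.snd this

theorem WalkConnectedOn.exists_adj_of_ssubset {S S' : Set V} (hS' : G.WalkConnectedOn S')
    (hne : S.Nonempty) (hss : S ⊂ S') : ∃ p ∈ S, ∃ y ∈ S', y ∉ S ∧ G.Adj p y := by
  obtain ⟨u, hu⟩ := hne
  obtain ⟨v, hv, hvS⟩ := Set.exists_of_ssubset hss
  obtain ⟨w, hw⟩ := hS' u (hss.1 hu) v hv
  obtain ⟨d, hd, h1, h2⟩ := w.exists_boundary_dart S hu hvS
  exact ⟨d.fst, h1, d.snd, hw _ (w.dart_snd_mem_support_of_mem_darts hd), h2, d.adj⟩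

/-- Backward induction from a connected set to a smaller one: the smaller set grows to the larger
one by adding vertices one at a time, each of which is adjacent to the set built so far. -/
theorem WalkConnectedOn.growth_induction [DecidableEq V] {S S' : Finset V}
    (hS : G.WalkConnectedOn (S : Set V)) (hS' : G.WalkConnectedOn (S' : Set V))
    (hne : S.Nonempty) (hss : S ⊆ S') {motive : Finset V → Prop}
    (base : motive S') (step : ∀ (R : Finset V) (p y : V), S ⊆ R → R.Nonempty →
      G.WalkConnectedOn (R : Set V) → p ∈ R → y ∉ R → G.Adj p y →
      motive (Insert.insert y R) → motive R) : motive S := by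
  induction hn : (S' \ S).card generalizing S with
  | zero =>
    have : S' ⊆ S := by
      rwa [Finset.card_eq_zero, Finset.sdiff_eq_empty_iff_subset] at hn
    rwa [hss.antisymm this]
  | succ n ih =>
    have hlt : (S : Set V) ⊂ S' := by
      rw [Finset.coe_ssubset, Finset.ssubset_iff_subset_ne]
      refine ⟨hss, ?_⟩
      rintro rfl
      simp at hn
    obtain ⟨p, hp, y, hy, hyS, hadj⟩ := hS'.exists_adj_of_ssubset (Finset.coe_nonempty.2 hne) hlt
    simp only [Finset.mem_coe] at hp hy hyS
    refine step S p y subset_rfl hne hS hp hyS hadj (ih ?_ ⟨y, by simp⟩ ?_ ?_ ?_)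
    · rw [Finset.coe_insert]
      exact hS.insert hp hadj
    · exact Finset.insert_subset hy hss
    · intro R p y hR
      exact step R p y ((Finset.subset_insert _ _).trans hR)
    · rw [Finset.sdiff_insert, Finset.card_erase_of_mem (by simp [hy, hyS]), hn]
      rfl

theorem IsTree.walkConnectedOn_ball (hG : G.IsTree) (r : V) (m : ℕ) :
    G.WalkConnectedOn {x | G.dist r x ≤ m} := by
  have key : ∀ n v, G.dist r v = n → n ≤ m → ∃ w : G.Walk v r, ∀ x ∈ w.support, G.dist r x ≤ m := by
    intro n
    induction n with
    | zero =>
      intro v hv _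
      obtain rfl : r = v := (hG.connected.dist_eq_zero_iff).1 hv
      exact ⟨.nil, by simp⟩
    | succ n ih =>
      intro v hv hnm
      have hne : v ≠ r := by rintro rfl; simp at hv
      obtain ⟨p, hp, hd⟩ := hG.exists_adj_dist_add_one hne
      obtain ⟨w, hw⟩ := ih p (by omega) (by omega)
      refine ⟨.cons hp w, fun x hx => ?_⟩
      rw [Walk.support_cons, List.mem_cons] at hx
      rcases hx with rfl | hx
      · omega
      · exact hw x hx
  intro u hu v hv
  obtain ⟨w, hw⟩ := key _ u rfl hu
  obtain ⟨w', hw'⟩ := key _ v rfl hv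
  refine ⟨w.append w'.reverse, fun x hx => ?_⟩
  rw [Walk.mem_support_append_iff, Walk.support_reverse, List.mem_reverse] at hx
  exact hx.elim (hw x) (hw' x)

end SimpleGraph

/-! ### The product of Lebesgue measures as reference measure -/

section Product

variable {V X : Type*} [MeasurableSpace X] (ν : Measure X) [IsProbabilityMeasure ν]

theorem map_update_infinitePi [DecidableEq V] (y : V) :
    ((Measure.infinitePi fun _ : V => ν).prod ν).map
      (fun z => Function.update z.1 y z.2) = Measure.infinitePi fun _ : V => ν := by
  have hmeas : Measurable fun z : (V → X) × X => Function.update z.1 y z.2 := by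
    refine measurable_pi_lambda _ fun x => ?_
    by_cases h : x = y
    · subst h; simpa using measurable_snd
    · simp only [Function.update_of_ne h]; fun_prop
  refine Measure.eq_infinitePi _ fun s t ht => ?_
  rw [Measure.map_apply hmeas (.pi s.countable_toSet fun _ _ => ht _)]
  have hpre : (fun z : (V → X) × X => Function.update z.1 y z.2) ⁻¹' (s : Set V).pi t =
      (((s.erase y : Finset V) : Set V).pi t) ×ˢ (if y ∈ s then t y else Set.univ) := by
    ext ⟨σ, u⟩
    simp only [Set.mem_preimage, Set.mem_pi, Finset.mem_coe, Set.mem_prod, Finset.mem_erase]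
    constructor
    · intro h
      refine ⟨fun i hi => by simpa [Function.update_of_ne hi.1] using h i hi.2, ?_⟩
      split_ifs with hy
      · simpa using h y hy
      · trivial
    · rintro ⟨h1, h2⟩ i hi
      by_cases hiy : i = y
      · subst hiy; simpa [hi] using h2
      · simpa [Function.update_of_ne hiy] using h1 i ⟨hiy, hi⟩
  rw [hpre, Measure.prod_prod, Measure.infinitePi_pi _ fun i _ => ht i]
  split_ifs with hy
  · rw [Finset.prod_erase_mul _ _ hy]
  · simp [Finset.erase_eq_of_notMem hy]

/-- Integration against a product measure can be carried out in the coordinate `y` first. -/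
theorem lintegral_infinitePi_update [DecidableEq V] (y : V) {F : (V → X) → ℝ≥0∞}
    (hF : Measurable F) :
    ∫⁻ σ, F σ ∂(Measure.infinitePi fun _ : V => ν) =
      ∫⁻ σ, ∫⁻ t, F (Function.update σ y t) ∂ν ∂(Measure.infinitePi fun _ : V => ν) := by
  have hmeas : Measurable fun z : (V → X) × X => Function.update z.1 y z.2 := by
    refine measurable_pi_lambda _ fun x => ?_
    by_cases h : x = y
    · subst h; simpa using measurable_snd
    · simp only [Function.update_of_ne h]; fun_prop
  conv_lhs => rw [← map_update_infinitePi ν y]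
  rw [lintegral_map hF hmeas,
    lintegral_prod (fun z => F (Function.update z.1 y z.2)) (hF.comp hmeas).aemeasurable]

theorem map_comp_infinitePi (e : V ≃ V) :
    (Measure.infinitePi fun _ : V => ν).map (fun σ x => σ (e x)) =
      Measure.infinitePi fun _ : V => ν := by
  have := Measure.infinitePi_map_piCongrLeft (fun _ : V => ν) e.symm
  convert! this using 2
  ext σ x
  have h := (MeasurableEquiv.piCongrLeft (fun _ : V => X) e.symm).symm_apply_apply
  simp [MeasurableEquiv.piCongrLeft, Equiv.piCongrLeft, Equiv.piCongrLeft']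

theorem DependsOn.exists_measurable_comp_restrict [Nonempty X] {S : Set V} {F : (V → X) → ℝ≥0∞}
    (hF : Measurable F) (hS : DependsOn F S) :
    ∃ F' : (S → X) → ℝ≥0∞, Measurable F' ∧ ∀ σ, F σ = F' fun x => σ x := by
  classical
  let ext : (S → X) → V → X := fun τ x => if h : x ∈ S then τ ⟨x, h⟩ else Classical.arbitrary X
  have hext : Measurable ext := by
    refine measurable_pi_lambda _ fun x => ?_
    by_cases h : x ∈ S
    · simp only [ext, h, dif_pos]; fun_prop
    · simp only [ext, h, dif_neg, not_false_eq_true]; exact measurable_const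
  refine ⟨F ∘ ext, hF.comp hext, fun σ => hS fun x hx => ?_⟩
  simp [ext, hx]

/-- The measure `μ` has density `D` with respect to `ν^V` when restricted to the coordinates in
`S`: it integrates the functions that depend on those coordinates as `D` does. -/
def HasDensityOn (μ : Measure (V → X)) (S : Set V) (D : (V → X) → ℝ≥0∞) : Prop :=
  ∀ F : (V → X) → ℝ≥0∞, Measurable F → DependsOn F S →
    ∫⁻ σ, F σ ∂μ = ∫⁻ σ, F σ * D σ ∂(Measure.infinitePi fun _ : V => ν)

theorem map_restrict_infinitePi (S : Set V) [Fintype S] :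
    (Measure.infinitePi fun _ : V => ν).map (fun σ (x : S) => σ x) =
      Measure.pi fun _ : S => ν := by
  rw [← Measure.infinitePi_eq_pi]
  exact Measure.infinitePi_map_restrict' (fun _ : V => ν) (I := S)

theorem hasDensityOn_iff_map [Nonempty X] (μ : Measure (V → X)) (S : Set V) [Fintype S]
    {d : (S → X) → ℝ≥0∞} (hd : Measurable d) :
    HasDensityOn ν μ S (fun σ => d fun x => σ x) ↔
      μ.map (fun σ (x : S) => σ x) = (Measure.pi fun _ : S => ν).withDensity d := by
  have hr : Measurable fun (σ : V → X) (x : S) => σ x := by fun_prop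
  have key : ∀ F : (S → X) → ℝ≥0∞, Measurable F →
      ∫⁻ σ : V → X, F (fun x => σ x) * d (fun x => σ x) ∂(Measure.infinitePi fun _ : V => ν) =
        ∫⁻ τ, F τ ∂(Measure.pi fun _ : S => ν).withDensity d := by
    intro F hF
    rw [lintegral_withDensity_eq_lintegral_mul _ hd hF, ← map_restrict_infinitePi,
      lintegral_map (hd.mul hF) hr]
    simp [mul_comm]
  constructor
  · intro h
    refine Measure.ext_of_lintegral _ fun F hF => ?_
    rw [← key F hF, lintegral_map hF hr, h (fun σ => F fun x => σ x) (hF.comp hr)]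
    intro σ τ hστ
    exact congrArg F (funext fun x => hστ x x.2)
  · intro h F hF hS
    obtain ⟨F', hF', hFF'⟩ := hS.exists_measurable_comp_restrict hF
    simp only [hFF']
    rw [key F' hF', ← h, lintegral_map hF' hr]

end Product

theorem HasDensityOn.ext {V X : Type*} [MeasurableSpace X] {ν : Measure X}
    {μ μ' : Measure (V → X)} [IsProbabilityMeasure μ] [IsProbabilityMeasure μ']
    {S : ℕ → Set V} {D : ℕ → (V → X) → ℝ≥0∞}
    (hS : ∀ I : Finset V, ∃ m, (I : Set V) ⊆ S m)
    (h : ∀ m, HasDensityOn ν μ (S m) (D m)) (h' : ∀ m, HasDensityOn ν μ' (S m) (D m)) :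
    μ = μ' := by
  refine IsProjectiveLimit.unique (P := fun I : Finset V => μ'.map I.restrict) ?_ fun I => rfl
  intro I
  obtain ⟨m, hm⟩ := hS I
  have hr : Measurable (I.restrict : (V → X) → (I → X)) := Finset.measurable_restrict I
  refine Measure.ext_of_lintegral _ fun F hF => ?_
  rw [lintegral_map hF hr, lintegral_map hF hr]
  have hdep : DependsOn (fun σ : V → X => F (I.restrict σ)) (S m) := fun σ τ hστ =>
    congrArg F (funext fun x => hστ x (hm x.2))
  exact (h m _ (hF.comp hr) hdep).trans (h' m _ (hF.comp hr) hdep).symm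

/-- Consistent densities on an exhausting sequence of sets of coordinates come from a probability
measure: a limit point of the measures with these densities, in the compact space of probability
measures on `[0,1]^V`. -/
theorem exists_hasDensityOn {V : Type*} [Countable V] {S : ℕ → Set V}
    {D : ℕ → (V → Spin) → ℝ≥0∞} (hD : ∀ m, Measurable (D m))
    (hone : ∀ m, ∫⁻ σ, D m σ ∂(Measure.infinitePi fun _ : V => (volume : Measure Spin)) = 1)
    (hcons : ∀ m m', m ≤ m' → ∀ F : (V → Spin) → ℝ≥0∞, Measurable F → DependsOn F (S m) →
      ∫⁻ σ, F σ * D m' σ ∂(Measure.infinitePi fun _ : V => (volume : Measure Spin)) =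
        ∫⁻ σ, F σ * D m σ ∂(Measure.infinitePi fun _ : V => (volume : Measure Spin)))
    (hfin : ∀ m, (S m).Finite) :
    ∃ μ : Measure (V → Spin), IsProbabilityMeasure μ ∧ ∀ m, HasDensityOn volume μ (S m) (D m) := by
  let P := Measure.infinitePi fun _ : V => (volume : Measure Spin)
  let ρ : ℕ → ProbabilityMeasure (V → Spin) := fun m =>
    ⟨P.withDensity (D m), ⟨by rw [withDensity_apply _ .univ]; simpa using hone m⟩⟩
  let U : Ultrafilter ℕ := Filter.hyperfilter ℕ
  obtain ⟨μ, hμ⟩ : ∃ μ, Filter.Tendsto ρ U (nhds μ) :=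
    ⟨_, (U.map ρ).le_nhds_lim⟩
  refine ⟨μ, inferInstance, fun m => ?_⟩
  have := (hfin m).fintype
  let r : (V → Spin) → (S m → Spin) := fun σ x => σ x
  have hrc : Continuous r := by fun_prop
  have hrm : Measurable r := by fun_prop
  have hlim := ProbabilityMeasure.tendsto_map_of_tendsto_of_continuous ρ μ hμ hrc
  have hev : ∀ᶠ m' in (U : Filter ℕ),
      (ρ m').map hrc.measurable.aemeasurable = (ρ m).map hrc.measurable.aemeasurable := by
    have hle : (U : Filter ℕ) ≤ Filter.atTop := Nat.hyperfilter_le_atTop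
    filter_upwards [hle (Filter.eventually_ge_atTop m)] with m' hm'
    refine Subtype.ext (Measure.ext_of_lintegral _ fun F hF => ?_)
    change ∫⁻ τ, F τ ∂(P.withDensity (D m')).map r = ∫⁻ τ, F τ ∂(P.withDensity (D m)).map r
    rw [lintegral_map hF hrm, lintegral_map hF hrm,
      lintegral_withDensity_eq_lintegral_mul _ (hD _) (g := fun σ => F (r σ)) (hF.comp hrm),
      lintegral_withDensity_eq_lintegral_mul _ (hD _) (g := fun σ => F (r σ)) (hF.comp hrm)]
    have := hcons m m' hm' (fun σ => F (r σ)) (hF.comp hrm)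
      fun σ τ hστ => congrArg F (funext fun x => hστ x x.2)
    simpa [mul_comm] using this
  have heq := tendsto_nhds_unique (hlim.congr' hev) tendsto_const_nhds
  have heq' : (μ : Measure (V → Spin)).map r = (P.withDensity (D m)).map r :=
    congrArg Subtype.val heq
  intro F hF hS
  obtain ⟨F', hF', hFF'⟩ := hS.exists_measurable_comp_restrict hF
  have h1 : ∫⁻ σ, F σ ∂(μ : Measure (V → Spin)) = ∫⁻ σ, F σ ∂(P.withDensity (D m)) := by
    simp only [hFF']
    change ∫⁻ σ, F' (r σ) ∂_ = ∫⁻ σ, F' (r σ) ∂_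
    rw [← lintegral_map hF' hrm, ← lintegral_map hF' hrm, heq']
  rw [h1, lintegral_withDensity_eq_lintegral_mul _ (hD _) hF]
  simp [P, mul_comm]

/-! ### Weights of configurations on finite sets of vertices -/

/-- The product of the Lebesgue measures over all vertices. -/
noncomputable abbrev refMeasure (V : Type*) : Measure (V → Spin) :=
  Measure.infinitePi fun _ : V => (volume : Measure Spin)

/-- Symmetric nonnegative kernels on the spin space. -/
abbrev SymmKernel : Type := {K : Spin → Spin → ℝ≥0∞ // ∀ t u, K t u = K u t}

namespace SimpleGraph

variable {V : Type*} {G : SimpleGraph V} {K : SymmKernel}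

variable (G) in
/-- The edges of `G` with both ends in `S`. -/
def inducedEdges (S : Set V) : Set (Sym2 V) := {e ∈ G.edgeSet | ∀ v ∈ e, v ∈ S}

theorem mem_inducedEdges {S : Set V} {a b : V} :
    s(a, b) ∈ G.inducedEdges S ↔ G.Adj a b ∧ a ∈ S ∧ b ∈ S := by
  simp [inducedEdges]

theorem inducedEdges_finite {S : Set V} (hS : S.Finite) : (G.inducedEdges S).Finite := by
  refine (((hS.prod hS).image fun z : V × V => s(z.1, z.2))).subset ?_
  intro e he
  induction e with
  | _ a b => exact ⟨(a, b), (mem_inducedEdges.1 he).2, rfl⟩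

theorem inducedEdges_insert {S : Set V} {p y : V} (hp : p ∈ S) (h : G.Adj p y)
    (huniq : ∀ p' ∈ S, G.Adj p' y → p' = p) :
    G.inducedEdges (insert y S) = insert s(p, y) (G.inducedEdges S) := by
  ext e
  induction e with
  | _ a b =>
    rw [Set.mem_insert_iff, mem_inducedEdges, mem_inducedEdges, Sym2.eq_iff]
    constructor
    · rintro ⟨hab, rfl | ha, rfl | hb⟩
      · exact absurd hab (G.irrefl)
      · exact Or.inl (Or.inr ⟨rfl, huniq b hb hab.symm⟩)
      · exact Or.inl (Or.inl ⟨huniq a ha hab, rfl⟩)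
      · exact Or.inr ⟨hab, ha, hb⟩
    · rintro ((⟨rfl, rfl⟩ | ⟨rfl, rfl⟩) | ⟨hab, ha, hb⟩)
      · exact ⟨h, Or.inr hp, Or.inl rfl⟩
      · exact ⟨h.symm, Or.inl rfl, Or.inr hp⟩
      · exact ⟨hab, Or.inr ha, Or.inr hb⟩

theorem inducedEdges_image (φ : G ≃g G) (S : Set V) :
    G.inducedEdges (φ '' S) = Sym2.map φ '' G.inducedEdges S := by
  ext e
  constructor
  · induction e with
    | _ a b =>
      intro he
      obtain ⟨hab, ⟨a', ha, rfl⟩, ⟨b', hb, rfl⟩⟩ := mem_inducedEdges.1 he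
      exact ⟨s(a', b'), mem_inducedEdges.2 ⟨(φ.map_adj_iff).1 hab, ha, hb⟩, rfl⟩
  · rintro ⟨e', he', rfl⟩
    induction e' with
    | _ a b =>
      obtain ⟨hab, ha, hb⟩ := mem_inducedEdges.1 he'
      exact mem_inducedEdges.2 ⟨(φ.map_adj_iff).2 hab, ⟨a, ha, rfl⟩, ⟨b, hb, rfl⟩⟩

variable (G K) in
/-- The product of the kernel `K` over the edges with both ends in `S`, for a configuration `σ` of
the whole graph. -/
noncomputable def edgeWeight (S : Set V) (σ : V → Spin) : ℝ≥0∞ :=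
  ∏ᶠ e ∈ G.inducedEdges S, Sym2.lift K (e.map σ)

theorem edgeWeight_eq_prod {S : Set V} (hS : S.Finite) (σ : V → Spin) :
    G.edgeWeight K S σ =
      ∏ e ∈ (inducedEdges_finite (G := G) hS).toFinset, Sym2.lift K (e.map σ) :=
  finprod_mem_eq_finite_toFinset_prod _ _

theorem edgeWeight_insert {S : Set V} (hS : S.Finite) {p y : V} (hp : p ∈ S) (hy : y ∉ S)
    (h : G.Adj p y) (huniq : ∀ p' ∈ S, G.Adj p' y → p' = p) (σ : V → Spin) :
    G.edgeWeight K (insert y S) σ = K.1 (σ p) (σ y) * G.edgeWeight K S σ := by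
  rw [edgeWeight, inducedEdges_insert hp h huniq, finprod_mem_insert _ _ (inducedEdges_finite hS)]
  · rfl
  · exact fun hmem => hy (mem_inducedEdges.1 hmem).2.2

theorem edgeWeight_image (φ : G ≃g G) (S : Set V) (σ : V → Spin) :
    G.edgeWeight K (φ '' S) σ = G.edgeWeight K S fun x => σ (φ x) := by
  rw [edgeWeight, inducedEdges_image, finprod_mem_image]
  · refine finprod_mem_congr rfl fun e _ => ?_
    rw [Sym2.map_map]
    rfl
  · exact (Sym2.map.injective φ.injective).injOn

theorem edgeWeight_dependsOn (S : Set V) : DependsOn (G.edgeWeight K S) S := by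
  intro σ τ h
  refine finprod_mem_congr rfl fun e he => ?_
  induction e with
  | _ a b =>
    obtain ⟨-, ha, hb⟩ := mem_inducedEdges.1 he
    simp [h a ha, h b hb]

theorem edgeWeight_update [DecidableEq V] {S : Set V} {y : V} (hy : y ∉ S) (σ : V → Spin)
    (t : Spin) : G.edgeWeight K S (Function.update σ y t) = G.edgeWeight K S σ :=
  edgeWeight_dependsOn S fun x hx => Function.update_of_ne (by rintro rfl; exact hy hx) _ _

theorem measurable_edgeWeight (hK : Measurable (Function.uncurry K.1)) {S : Set V}
    (hS : S.Finite) : Measurable (G.edgeWeight K S) := by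
  rw [show G.edgeWeight K S = fun σ => _ from funext (edgeWeight_eq_prod hS)]
  refine Finset.measurable_prod _ fun e _ => ?_
  induction e with
  | _ a b =>
    exact hK.comp ((measurable_pi_apply a).prodMk (measurable_pi_apply b))

theorem edgeWeight_ne_zero (hK : ∀ t u, K.1 t u ≠ 0) {S : Set V} (hS : S.Finite)
    (σ : V → Spin) : G.edgeWeight K S σ ≠ 0 := by
  rw [edgeWeight_eq_prod hS]
  refine Finset.prod_ne_zero_iff.2 fun e _ => ?_
  induction e with
  | _ a b => exact hK _ _

theorem edgeWeight_singleton (v : V) (σ : V → Spin) : G.edgeWeight K {v} σ = 1 := by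
  have : G.inducedEdges {v} = ∅ := by
    ext e
    induction e with
    | _ a b =>
      rw [mem_inducedEdges]
      simp only [Set.mem_singleton_iff, Set.mem_empty_iff_false, iff_false]
      rintro ⟨h, rfl, rfl⟩
      exact G.irrefl h
  rw [edgeWeight, this, finprod_mem_empty]

/-! ### The consistent densities given by a fixed point of the boundary law equation -/

/-- `L` solves the boundary law equation of the kernel `K` on the tree with `k` children at each
vertex: the message `L ^ k` sent along an edge produces the factor `A L`. -/
structure IsBoundaryLaw (K : SymmKernel) (k : ℕ) (L : Spin → ℝ≥0∞) (A : ℝ≥0∞) : Prop where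
  measurable_kernel : Measurable (Function.uncurry K.1)
  measurable : Measurable L
  ne_zero : A ≠ 0
  ne_top : A ≠ ∞
  lintegral_eq : ∀ s, ∫⁻ t, K.1 s t * L t ^ k = A * L s

variable (G) in
/-- The number of neighbours of `x` outside `S`. -/
noncomputable def outDegree (S : Set V) (x : V) : ℕ := (G.neighborSet x \ S).ncard

theorem outDegree_image (φ : G ≃g G) (S : Set V) (x : V) :
    G.outDegree (φ '' S) (φ x) = G.outDegree S x := by
  have : G.neighborSet (φ x) \ φ '' S = φ '' (G.neighborSet x \ S) := by
    rw [Set.image_sdiff φ.injective]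
    congr 1
    ext y
    constructor
    · intro hy
      exact ⟨φ.symm y, (φ.map_adj_iff).1 (by simpa using hy), by simp⟩
    · rintro ⟨z, hz, rfl⟩
      exact (φ.map_adj_iff).2 hz
  rw [outDegree, this, Set.ncard_image_of_injective _ φ.injective, outDegree]

variable (G K) in
/-- The density on `S` of the Gibbs measure that is given by the factors `L`. The constants `A` and
`M` are such that it integrates to one, see `lintegral_splittingDensity`. -/
noncomputable def splittingDensity (L : Spin → ℝ≥0∞) (A M : ℝ≥0∞) (S : Finset V)
    (σ : V → Spin) : ℝ≥0∞ :=
  M * A⁻¹ ^ S.card * (G.edgeWeight K S σ * ∏ x ∈ S, L (σ x) ^ G.outDegree S x)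

theorem measurable_splittingDensity {L : Spin → ℝ≥0∞} (hK : Measurable (Function.uncurry K.1))
    (hL : Measurable L) (A M : ℝ≥0∞) (S : Finset V) :
    Measurable (G.splittingDensity K L A M S) := by
  refine ((measurable_edgeWeight hK S.finite_toSet).mul ?_).const_mul _
  refine Finset.measurable_prod _ fun x _ => ?_
  exact (hL.comp (measurable_pi_apply x)).pow_const _

theorem splittingDensity_image [DecidableEq V] (L : Spin → ℝ≥0∞) (A M : ℝ≥0∞) (φ : G ≃g G)
    (S : Finset V) (σ : V → Spin) :
    G.splittingDensity K L A M (S.image φ) σ =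
      G.splittingDensity K L A M S fun x => σ (φ x) := by
  simp only [splittingDensity, Finset.coe_image, edgeWeight_image]
  rw [Finset.card_image_of_injective _ φ.injective,
    Finset.prod_image (fun x _ y _ h => φ.injective h)]
  simp only [outDegree_image]

variable {k : ℕ} {L : Spin → ℝ≥0∞} {A M : ℝ≥0∞}

theorem finite_neighborSet_of_ncard (hdeg : ∀ x, (G.neighborSet x).ncard = k + 1) (x : V) :
    (G.neighborSet x).Finite :=
  Set.finite_of_ncard_ne_zero (by rw [hdeg]; omega)

/-- Integrating out a vertex with a single neighbour in the set leaves the density on the rest. -/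
theorem lintegral_splittingDensity_insert [DecidableEq V]
    (hdeg : ∀ x, (G.neighborSet x).ncard = k + 1) (hG : G.IsTree)
    (hL : IsBoundaryLaw K k L A)
    {R : Finset V} {p y : V} (hR : G.WalkConnectedOn (R : Set V)) (hp : p ∈ R) (hy : y ∉ R)
    (h : G.Adj p y) (σ : V → Spin) :
    ∫⁻ t, G.splittingDensity K L A M (insert y R) (Function.update σ y t) =
      G.splittingDensity K L A M R σ := by
  have hyR : y ∉ (R : Set V) := hy
  have hpy : p ≠ y := h.ne
  have huniq : ∀ p' ∈ (R : Set V), G.Adj p' y → p' = p := fun p' hp' hadj =>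
    hG.eq_of_adj_of_walkConnectedOn hR hyR hp' hp hadj.symm h.symm
  have hy_out : G.outDegree (insert y (R : Set V)) y = k := by
    have : G.neighborSet y \ insert y (R : Set V) = G.neighborSet y \ {p} := by
      ext x
      simp only [Set.mem_sdiff, mem_neighborSet, Set.mem_insert_iff, Set.mem_singleton_iff, not_or]
      constructor
      · rintro ⟨hx, -, hxR⟩
        exact ⟨hx, by rintro rfl; exact hxR hp⟩
      · rintro ⟨hx, hxp⟩
        exact ⟨hx, hx.ne', fun hxR => hxp (huniq x hxR hx.symm)⟩
    rw [outDegree, this, Set.ncard_sdiff_singleton_of_mem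
      (show p ∈ G.neighborSet y from h.symm), hdeg]
    rfl
  have hp_out : G.outDegree (R : Set V) p = G.outDegree (insert y (R : Set V)) p + 1 := by
    have : G.neighborSet p \ (R : Set V) = insert y (G.neighborSet p \ insert y (R : Set V)) := by
      ext x
      simp only [Set.mem_sdiff, mem_neighborSet, Set.mem_insert_iff, not_or]
      constructor
      · rintro ⟨hx, hxR⟩
        by_cases hxy : x = y
        · exact Or.inl hxy
        · exact Or.inr ⟨hx, hxy, hxR⟩
      · rintro (rfl | ⟨hx, -, hxR⟩)
        · exact ⟨h, hyR⟩
        · exact ⟨hx, hxR⟩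
    rw [outDegree, this, Set.ncard_insert_of_notMem (by simp)
      ((finite_neighborSet_of_ncard hdeg p).sdiff), outDegree]
  have hx_out : ∀ x ∈ R.erase p,
      G.outDegree (insert y (R : Set V)) x = G.outDegree (R : Set V) x := by
    intro x hx
    rw [Finset.mem_erase] at hx
    rw [outDegree, outDegree]
    congr 1
    ext z
    simp only [Set.mem_sdiff, mem_neighborSet, Set.mem_insert_iff, not_or, and_congr_right_iff,
      and_iff_right_iff_imp]
    rintro hz - rfl
    exact hx.1 (huniq x hx.2 hz)
  have hD : ∀ t, G.splittingDensity K L A M (insert y R) (Function.update σ y t) =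
      M * A⁻¹ ^ (R.card + 1) * (G.edgeWeight K R σ *
        ∏ x ∈ R, L (σ x) ^ G.outDegree (insert y (R : Set V)) x) * (K.1 (σ p) t * L t ^ k) := by
    intro t
    rw [splittingDensity, Finset.card_insert_of_notMem hy, Finset.coe_insert,
      edgeWeight_insert R.finite_toSet hp hyR h huniq, Finset.prod_insert hy, hy_out,
      edgeWeight_update hyR, Function.update_self, Function.update_of_ne hpy]
    have : ∏ x ∈ R, L (Function.update σ y t x) ^ G.outDegree (insert y (R : Set V)) x =
        ∏ x ∈ R, L (σ x) ^ G.outDegree (insert y (R : Set V)) x :=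
      Finset.prod_congr rfl fun x hx => by
        rw [Function.update_of_ne (by rintro rfl; exact hy hx)]
    rw [this]
    ring
  have hKm : Measurable fun t => K.1 (σ p) t * L t ^ k :=
    (hL.measurable_kernel.comp (measurable_const.prodMk measurable_id)).mul
      (hL.measurable.pow_const _)
  simp only [hD]
  rw [lintegral_const_mul _ hKm, hL.lintegral_eq, splittingDensity, ← Finset.mul_prod_erase R _ hp,
    ← Finset.mul_prod_erase R (fun x => L (σ x) ^ G.outDegree (R : Set V) x) hp,
    Finset.prod_congr rfl fun x hx => by rw [hx_out x hx], hp_out, pow_succ A⁻¹, pow_succ (L (σ p))]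
  calc _ = (A⁻¹ * A) * (M * A⁻¹ ^ R.card * (G.edgeWeight K (R : Set V) σ *
        (L (σ p) ^ G.outDegree (insert y (R : Set V)) p * L (σ p) *
          ∏ x ∈ R.erase p, L (σ x) ^ G.outDegree (R : Set V) x))) := by ring
    _ = _ := by rw [ENNReal.inv_mul_cancel hL.ne_zero hL.ne_top, one_mul]

theorem lintegral_mul_splittingDensity_of_subset [DecidableEq V]
    (hdeg : ∀ x, (G.neighborSet x).ncard = k + 1) (hG : G.IsTree)
    (hL : IsBoundaryLaw K k L A)
    {S S' : Finset V} (hS : G.WalkConnectedOn (S : Set V)) (hS' : G.WalkConnectedOn (S' : Set V))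
    (hne : S.Nonempty) (hss : S ⊆ S') {F : (V → Spin) → ℝ≥0∞} (hF : Measurable F)
    (hFS : DependsOn F (S : Set V)) :
    ∫⁻ σ, F σ * G.splittingDensity K L A M S' σ ∂(refMeasure V) =
      ∫⁻ σ, F σ * G.splittingDensity K L A M S σ ∂(refMeasure V) := by
  refine hS.growth_induction hS' hne hss (motive := fun R =>
    ∫⁻ σ, F σ * G.splittingDensity K L A M S' σ ∂(refMeasure V) =
      ∫⁻ σ, F σ * G.splittingDensity K L A M R σ ∂(refMeasure V)) rfl ?_
  intro R p y hSR _ hR hp hy hadj ih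
  rw [ih, lintegral_infinitePi_update volume y
    (F := fun σ => F σ * G.splittingDensity K L A M (insert y R) σ)
    (hF.mul (measurable_splittingDensity hL.measurable_kernel hL.measurable A M (insert y R)))]
  refine lintegral_congr fun σ => ?_
  have hFu : ∀ t, F (Function.update σ y t) = F σ := fun t =>
    hFS fun x hx => Function.update_of_ne (by rintro rfl; exact hy (hSR hx)) _ _
  have hm : Measurable fun t => G.splittingDensity K L A M (insert y R) (Function.update σ y t) :=
    (measurable_splittingDensity hL.measurable_kernel hL.measurable A M (insert y R)).comp
      (measurable_update σ)
  simp only [hFu]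
  rw [lintegral_const_mul _ hm,
    lintegral_splittingDensity_insert hdeg hG hL hR hp hy hadj]

theorem lintegral_splittingDensity [DecidableEq V]
    (hdeg : ∀ x, (G.neighborSet x).ncard = k + 1) (hG : G.IsTree)
    (hL : IsBoundaryLaw K k L A)
    (hM : M * A⁻¹ * ∫⁻ t, L t ^ (k + 1) = 1)
    {S : Finset V} (hS : G.WalkConnectedOn (S : Set V)) (hne : S.Nonempty) :
    ∫⁻ σ, G.splittingDensity K L A M S σ ∂(refMeasure V) = 1 := by
  obtain ⟨v, hv⟩ := hne
  have h := lintegral_mul_splittingDensity_of_subset (M := M) hdeg hG hL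
    (S := {v}) (by simpa using walkConnectedOn_singleton v) hS (by simp) (by simpa)
    (F := fun _ => 1) measurable_const fun _ _ _ => rfl
  simp only [one_mul] at h
  rw [h, ← hM]
  have hout : G.outDegree {v} v = k + 1 := by
    rw [outDegree, Set.sdiff_singleton_eq_self (by simp), hdeg]
  have hd : ∀ σ : V → Spin, G.splittingDensity K L A M {v} σ =
      M * A⁻¹ * L (σ v) ^ (k + 1) := by
    intro σ
    simp [splittingDensity, edgeWeight_singleton, hout]
  simp only [hd]
  have hm : Measurable fun t => L t ^ (k + 1) := hL.measurable.pow_const _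
  rw [lintegral_const_mul _ (f := fun σ : V → Spin => L (σ v) ^ (k + 1))
      (hm.comp (measurable_pi_apply v)),
    ← (measurePreserving_eval_infinitePi (fun _ : V => (volume : Measure Spin))
      v).lintegral_comp hm]

end SimpleGraph

/-! ### Balls and spheres of the Cayley tree -/

namespace CayleyTree

open SimpleGraph

variable {k : ℕ} {V : Type*} (T : CayleyTree k V) (x₀ : V)

/-- The parent of a vertex in the tree rooted at `x₀`; the root is its own parent. -/
noncomputable def parent (y : V) : V := T.graph.treeParent x₀ x₀ y

variable {x₀}

theorem mem_ball {m : ℕ} {x : V} : x ∈ T.ball x₀ m ↔ T.graph.dist x₀ x ≤ m := Iff.rfl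

theorem mem_sphere {m : ℕ} {x : V} : x ∈ T.sphere x₀ m ↔ T.graph.dist x₀ x = m := Iff.rfl

theorem ne_root_of_mem_sphere {m : ℕ} {x : V} (hx : x ∈ T.sphere x₀ (m + 1)) : x ≠ x₀ := by
  rintro rfl
  simp [mem_sphere] at hx

theorem parent_mem_sphere {m : ℕ} {y : V} (hy : y ∈ T.sphere x₀ (m + 1)) :
    T.parent x₀ y ∈ T.sphere x₀ m := by
  have := (T.isTree.treeParent_spec (a := x₀) (T.ne_root_of_mem_sphere hy)).2
  rw [mem_sphere] at hy ⊢
  rw [parent]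
  omega

theorem adj_parent {y : V} (hy : y ≠ x₀) : T.graph.Adj (T.parent x₀ y) y :=
  (T.isTree.treeParent_spec (a := x₀) hy).1.symm

theorem eq_parent {y p : V} (hy : y ≠ x₀) (h : T.graph.Adj p y)
    (hd : T.graph.dist x₀ p ≤ T.graph.dist x₀ y) : p = T.parent x₀ y :=
  (T.isTree.eq_treeParent_iff hy).2
    ⟨h.symm, lt_of_le_of_ne hd (T.isTree.dist_ne_of_adj x₀ h)⟩

theorem notMem_ball {m : ℕ} {y : V} (hy : y ∈ T.sphere x₀ (m + 1)) : y ∉ T.ball x₀ m := by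
  rw [mem_sphere] at hy
  rw [mem_ball]
  omega

theorem root_mem_ball (m : ℕ) : x₀ ∈ T.ball x₀ m := by simp [mem_ball]

theorem exists_subset_ball (I : Finset V) : ∃ m, (I : Set V) ⊆ T.ball x₀ m :=
  ⟨I.sup (T.graph.dist x₀), fun _ hx => Finset.le_sup (f := T.graph.dist x₀) hx⟩

theorem countable {k : ℕ} {V : Type*} (T : CayleyTree k V) (x₀ : V) : Countable V := by
  have h : (⋃ m, T.ball x₀ m) = Set.univ :=
    Set.eq_univ_of_forall fun x => Set.mem_iUnion.2 ⟨T.graph.dist x₀ x, T.mem_ball.2 le_rfl⟩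
  rw [← Set.countable_univ_iff, ← h]
  exact Set.countable_iUnion fun m => (T.ball_finite x₀ m).countable

theorem ncard_children {x : V} (hx : x ≠ x₀) :
    {y | T.graph.Adj x y ∧ T.graph.dist x₀ y = T.graph.dist x₀ x + 1}.ncard = k := by
  have h : {y | T.graph.Adj x y ∧ T.graph.dist x₀ y = T.graph.dist x₀ x + 1} =
      T.graph.neighborSet x \ {T.parent x₀ x} := by
    ext y
    simp only [Set.mem_ofPred_eq, Set.mem_sdiff, mem_neighborSet, Set.mem_singleton_iff]
    constructor
    · rintro ⟨h1, h2⟩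
      refine ⟨h1, ?_⟩
      rintro rfl
      have := (T.isTree.treeParent_spec (a := x₀) hx).2
      rw [parent] at h2
      omega
    · rintro ⟨h1, h2⟩
      refine ⟨h1, ?_⟩
      rcases T.isTree.dist_eq_dist_add_one_of_adj x₀ h1 with h | h
      · exact absurd (T.eq_parent hx h1.symm (by omega)) h2
      · exact h
  rw [h, Set.ncard_sdiff_singleton_of_mem
    (show T.parent x₀ x ∈ T.graph.neighborSet x from (T.adj_parent hx).symm),
    T.ncard_neighborSet]
  rfl

theorem outDegree_ball_of_lt {m : ℕ} {x : V} (hx : T.graph.dist x₀ x < m) :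
    T.graph.outDegree (T.ball x₀ m) x = 0 := by
  rw [outDegree, Set.sdiff_eq_empty.2, Set.ncard_empty]
  intro y hy
  rw [mem_ball]
  rcases T.isTree.dist_eq_dist_add_one_of_adj x₀ hy with h | h <;> omega

theorem outDegree_ball_of_mem_sphere {m : ℕ} {x : V} (hx : x ∈ T.sphere x₀ (m + 1)) :
    T.graph.outDegree (T.ball x₀ (m + 1)) x = k := by
  refine Eq.trans ?_ (T.ncard_children (T.ne_root_of_mem_sphere hx))
  rw [outDegree]
  congr 1
  ext y
  rw [mem_sphere] at hx
  simp only [Set.mem_sdiff, mem_neighborSet, mem_ball, Set.mem_ofPred_eq, hx,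
    and_congr_right_iff]
  intro hxy
  rcases T.isTree.dist_eq_dist_add_one_of_adj x₀ hxy with h | h <;> omega

theorem ball_succ (m : ℕ) : T.ball x₀ (m + 1) = T.ball x₀ m ∪ T.sphere x₀ (m + 1) := by
  ext x
  simp only [mem_ball, Set.mem_union, mem_sphere]
  omega

variable (x₀) in
theorem card_ball_succ (m : ℕ) : (T.ball x₀ (m + 1)).toFinset.card =
    (T.ball x₀ m).toFinset.card + (T.sphere x₀ (m + 1)).toFinset.card := by
  classical
  rw [← Finset.card_union_of_disjoint]
  · congr 1
    ext x
    simp [ball_succ]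
  · rw [Finset.disjoint_left]
    intro x hx hx'
    rw [Set.mem_toFinset] at hx hx'
    exact T.notMem_ball hx' hx

/-! ### Weights on balls -/

variable {K : SymmKernel}

variable (x₀ K) in
/-- The weight of a configuration on the ball `V_m` with the factors `f x` on the sphere `W_m`. -/
noncomputable def ballWeight (f : V → Spin → ℝ≥0∞) (m : ℕ) (σ : V → Spin) : ℝ≥0∞ :=
  T.graph.edgeWeight K (T.ball x₀ m) σ * ∏ x ∈ (T.sphere x₀ m).toFinset, f x (σ x)

theorem measurable_ballWeight (hK : Measurable (Function.uncurry K.1)) {f : V → Spin → ℝ≥0∞}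
    {m : ℕ} (hf : ∀ x ∈ T.sphere x₀ m, Measurable (f x)) :
    Measurable (T.ballWeight x₀ K f m) := by
  refine (measurable_edgeWeight hK (T.ball_finite x₀ m)).mul ?_
  exact Finset.measurable_prod _ fun x hx =>
    (hf x (Set.mem_toFinset.1 hx)).comp (measurable_pi_apply x)

theorem ballWeight_dependsOn (f : V → Spin → ℝ≥0∞) (m : ℕ) :
    DependsOn (T.ballWeight x₀ K f m) (T.ball x₀ m) := by
  intro σ τ h
  rw [ballWeight, ballWeight, edgeWeight_dependsOn _ h]
  congr 1
  refine Finset.prod_congr rfl fun x hx => ?_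
  rw [h x (T.sphere_subset_ball x₀ m (Set.mem_toFinset.1 hx))]

/-- The Boltzmann factor `exp (J β ξ)` of an interaction `ξ`. -/
noncomputable def boltzmannKernel (J β : ℝ) (ξ : {ξ : Spin → Spin → ℝ // ∀ t u, ξ t u = ξ u t}) :
    SymmKernel :=
  ⟨fun t u => ENNReal.ofReal (Real.exp (J * β * ξ.1 t u)), fun t u => by simp only [ξ.2 t u]⟩

theorem weight_eq_ballWeight (J β : ℝ) (ξ : {ξ : Spin → Spin → ℝ // ∀ t u, ξ t u = ξ u t})
    (h : V → Spin → ℝ) (m : ℕ) (σ : V → Spin) :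
    T.weight x₀ J β ξ h m (fun x => σ x) =
      T.ballWeight x₀ (boltzmannKernel J β ξ) (fun x t => ENNReal.ofReal (Real.exp (h x t))) m
        σ := by
  have himage : T.graph.inducedEdges (T.ball x₀ m) =
      Sym2.map Subtype.val '' (T.graph.induce (T.ball x₀ m)).edgeSet := by
    ext e
    constructor
    · induction e with
      | _ a b =>
        intro he
        obtain ⟨hab, ha, hb⟩ := mem_inducedEdges.1 he
        exact ⟨s(⟨a, ha⟩, ⟨b, hb⟩), hab, rfl⟩
    · rintro ⟨e', he', rfl⟩
      induction e' with
      | _ a b => exact mem_inducedEdges.2 ⟨he', a.2, b.2⟩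
  have hH : T.hamiltonian x₀ J ξ m (fun x => σ x) =
      -J * ∑ e ∈ (inducedEdges_finite (G := T.graph) (T.ball_finite x₀ m)).toFinset,
        Sym2.lift ξ (e.map σ) := by
    rw [hamiltonian, ← finsum_mem_eq_finite_toFinset_sum, himage,
      finsum_mem_image (Sym2.map.injective Subtype.val_injective).injOn]
    congr 1
    refine finsum_mem_congr rfl fun e _ => ?_
    rw [Sym2.map_map]
    rfl
  rw [weight, hH, Real.exp_add, ENNReal.ofReal_mul (Real.exp_nonneg _), ballWeight,
    edgeWeight_eq_prod (T.ball_finite x₀ m), Real.exp_sum,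
    ENNReal.ofReal_prod_of_nonneg fun _ _ => Real.exp_nonneg _]
  congr 1
  · rw [show ∀ S : ℝ, -β * (-J * S) = J * β * S by intro S; ring, Finset.mul_sum, Real.exp_sum,
      ENNReal.ofReal_prod_of_nonneg fun _ _ => Real.exp_nonneg _]
    refine Finset.prod_congr rfl fun e _ => ?_
    induction e with
    | _ a b => rfl
  · exact Finset.prod_set_coe (T.sphere x₀ m)
      (f := fun x => ENNReal.ofReal (Real.exp (h x (σ x))))

/-- Adding the sphere `W_{m+1}` to the ball `V_m` adds the edges to the parents. -/
theorem edgeWeight_ball_succ (m : ℕ) (σ : V → Spin) :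
    T.graph.edgeWeight K (T.ball x₀ (m + 1)) σ = T.graph.edgeWeight K (T.ball x₀ m) σ *
      ∏ y ∈ (T.sphere x₀ (m + 1)).toFinset, K.1 (σ (T.parent x₀ y)) (σ y) := by
  classical
  have key : ∀ Y : Finset V, (∀ y ∈ Y, y ∈ T.sphere x₀ (m + 1)) →
      T.graph.edgeWeight K (T.ball x₀ m ∪ Y) σ = T.graph.edgeWeight K (T.ball x₀ m) σ *
        ∏ y ∈ Y, K.1 (σ (T.parent x₀ y)) (σ y) := by
    intro Y
    induction Y using Finset.induction_on with
    | empty => simp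
    | insert y Y hy ih =>
      intro hY
      have hyS := hY y (Finset.mem_insert_self y Y)
      have hY' : ∀ y ∈ Y, y ∈ T.sphere x₀ (m + 1) := fun z hz => hY z (Finset.mem_insert_of_mem hz)
      have hne := T.ne_root_of_mem_sphere hyS
      have hp := T.parent_mem_sphere hyS
      rw [Finset.coe_insert, Set.union_insert, edgeWeight_insert (p := T.parent x₀ y)
        ((T.ball_finite x₀ m).union Y.finite_toSet)
        (Or.inl (T.sphere_subset_ball x₀ m hp)) _ (T.adj_parent hne), ih hY',
        Finset.prod_insert hy]
      · ring
      · intro p' hp' hadj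
        refine T.eq_parent hne hadj ?_
        rw [mem_sphere] at hyS
        rcases hp' with hp' | hp'
        · rw [mem_ball] at hp'; omega
        · have := hY' p' hp'
          rw [mem_sphere] at this; omega
      · rintro (h | h)
        · exact T.notMem_ball hyS h
        · exact hy h
  have := key (T.sphere x₀ (m + 1)).toFinset fun y hy => Set.mem_toFinset.1 hy
  rwa [Set.coe_toFinset, ← ball_succ] at this

open Classical in
variable (x₀) in
/-- The configuration `σ`, with the spins on the sphere `W_m` replaced by `ω`. -/
noncomputable def glue (m : ℕ) (σ : V → Spin) (ω : T.sphere x₀ m → Spin) : V → Spin := fun x =>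
  if hx : x ∈ T.sphere x₀ m then ω ⟨x, hx⟩ else σ x

theorem concat_eq_glue (m : ℕ) (σ : V → Spin) (ω : T.sphere x₀ (m + 1) → Spin) :
    T.concat x₀ m (fun x => σ x) ω =
      fun x : T.ball x₀ (m + 1) => T.glue x₀ (m + 1) σ ω x := by
  funext ⟨x, hx⟩
  rw [mem_ball] at hx
  by_cases h : T.graph.dist x₀ x ≤ m
  · have h' : x ∉ T.sphere x₀ (m + 1) := fun hs => T.notMem_ball hs h
    simp [concat, glue, h, h']
  · have h' : x ∈ T.sphere x₀ (m + 1) := by rw [mem_sphere]; omega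
    simp [concat, glue, h, h']

theorem lintegral_pi_prod {ι : Type*} [Fintype ι] {g : ι → Spin → ℝ≥0∞}
    (hg : ∀ i, Measurable (g i)) :
    ∫⁻ ω : ι → Spin, ∏ i, g i (ω i) = ∏ i, ∫⁻ t, g i t := by
  have hind := ProbabilityTheory.iIndepFun_pi (μ := fun _ : ι => (volume : Measure Spin))
    (X := g) fun i => (hg i).aemeasurable
  have h := ProbabilityTheory.lintegral_prod_eq_prod_lintegral_of_indepFun Finset.univ
    (fun i (ω : ι → Spin) => g i (ω i)) hind fun i => (hg i).comp (measurable_pi_apply i)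
  rw [volume_pi, h]
  refine Finset.prod_congr rfl fun i _ => ?_
  exact (measurePreserving_eval (fun _ : ι => (volume : Measure Spin)) i).lintegral_comp (hg i)

/-- Integrating out the spins on `W_{m+1}`, when each of them sends the message `A y * L` to its
parent, leaves the weight on `V_m` with the factors `L ^ k`. -/
theorem lintegral_ballWeight_glue (hK : Measurable (Function.uncurry K.1))
    {f : V → Spin → ℝ≥0∞} {L : Spin → ℝ≥0∞} {A : V → ℝ≥0∞} {m : ℕ}
    (hf : ∀ y ∈ T.sphere x₀ (m + 2), Measurable (f y))
    (hfL : ∀ y ∈ T.sphere x₀ (m + 2), ∀ s, ∫⁻ t, K.1 s t * f y t = A y * L s) (σ : V → Spin) :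
    ∫⁻ ω, T.ballWeight x₀ K f (m + 2) (T.glue x₀ (m + 2) σ ω) =
      (∏ y ∈ (T.sphere x₀ (m + 2)).toFinset, A y) *
        T.ballWeight x₀ K (fun _ t => L t ^ k) (m + 1) σ := by
  classical
  have hparent : ∀ y ∈ T.sphere x₀ (m + 2), ∀ ω, T.glue x₀ (m + 2) σ ω (T.parent x₀ y) =
      σ (T.parent x₀ y) := by
    intro y hy ω
    have h1 := T.parent_mem_sphere hy
    have h2 : T.parent x₀ y ∉ T.sphere x₀ (m + 2) := by
      rw [mem_sphere] at h1 ⊢; omega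
    simp [glue, h2]
  have hglue : ∀ ω, T.ballWeight x₀ K f (m + 2) (T.glue x₀ (m + 2) σ ω) =
      T.graph.edgeWeight K (T.ball x₀ (m + 1)) σ * ∏ y : T.sphere x₀ (m + 2),
        (K.1 (σ (T.parent x₀ y)) (ω y) * f y (ω y)) := by
    intro ω
    have hd : T.graph.edgeWeight K (T.ball x₀ (m + 1)) (T.glue x₀ (m + 2) σ ω) =
        T.graph.edgeWeight K (T.ball x₀ (m + 1)) σ := by
      refine edgeWeight_dependsOn _ fun x hx => ?_
      have : x ∉ T.sphere x₀ (m + 2) := fun hs => T.notMem_ball hs hx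
      simp [glue, this]
    rw [ballWeight, edgeWeight_ball_succ, hd, mul_assoc, ← Finset.prod_mul_distrib,
      ← Finset.prod_set_coe (T.sphere x₀ (m + 2))]
    congr 1
    refine Finset.prod_congr rfl fun y _ => ?_
    rw [hparent y y.2]
    simp [glue]
  have hm : ∀ y : T.sphere x₀ (m + 2), Measurable fun t =>
      K.1 (σ (T.parent x₀ y)) t * f y t := fun y =>
    (hK.comp (measurable_const.prodMk measurable_id)).mul (hf y y.2)
  simp only [hglue]
  have hprod : Measurable fun ω : T.sphere x₀ (m + 2) → Spin =>
      ∏ y : T.sphere x₀ (m + 2), (K.1 (σ (T.parent x₀ y)) (ω y) * f y (ω y)) :=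
    Finset.measurable_prod _ fun y _ => (hm y).comp (measurable_pi_apply y)
  rw [lintegral_const_mul _ hprod, lintegral_pi_prod hm]
  have h1 : ∏ y : T.sphere x₀ (m + 2), ∫⁻ t, K.1 (σ (T.parent x₀ y)) t * f y t =
      ∏ y ∈ (T.sphere x₀ (m + 2)).toFinset, (A y * L (σ (T.parent x₀ y))) := by
    rw [← Finset.prod_set_coe (T.sphere x₀ (m + 2))]
    exact Finset.prod_congr rfl fun y _ => hfL y y.2 _
  have h2 : ∏ y ∈ (T.sphere x₀ (m + 2)).toFinset, L (σ (T.parent x₀ y)) =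
      ∏ x ∈ (T.sphere x₀ (m + 1)).toFinset, L (σ x) ^ k := by
    rw [← Finset.prod_fiberwise_of_maps_to (g := T.parent x₀) (t := (T.sphere x₀ (m + 1)).toFinset)
      fun y hy => Set.mem_toFinset.2 (T.parent_mem_sphere (Set.mem_toFinset.1 hy))]
    refine Finset.prod_congr rfl fun x hx => ?_
    rw [Set.mem_toFinset] at hx
    have hcard : ((T.sphere x₀ (m + 2)).toFinset.filter fun y => T.parent x₀ y = x).card = k := by
      refine Eq.trans ?_ (T.ncard_children (T.ne_root_of_mem_sphere hx))
      rw [← Set.ncard_coe_finset]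
      congr 1
      ext y
      rw [mem_sphere] at hx
      simp only [Finset.coe_filter, Set.mem_toFinset, Set.mem_ofPred_eq, mem_sphere, hx]
      constructor
      · rintro ⟨h1, rfl⟩
        exact ⟨T.adj_parent (T.ne_root_of_mem_sphere (m := m + 1) h1), h1⟩
      · rintro ⟨h1, h2⟩
        exact ⟨h2, (T.eq_parent (T.ne_root_of_mem_sphere (m := m + 1) h2) h1 (by omega)).symm⟩
    rw [Finset.prod_congr rfl fun y hy => by rw [(Finset.mem_filter.1 hy).2],
      Finset.prod_const, hcard]
  rw [h1, Finset.prod_mul_distrib, h2, ballWeight]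
  ring

theorem splittingDensity_ball (L : Spin → ℝ≥0∞) (A M : ℝ≥0∞) (m : ℕ) (σ : V → Spin) :
    T.graph.splittingDensity K L A M (T.ball x₀ (m + 1)).toFinset σ =
      M * A⁻¹ ^ (T.ball x₀ (m + 1)).toFinset.card *
        T.ballWeight x₀ K (fun _ t => L t ^ k) (m + 1) σ := by
  rw [splittingDensity, ballWeight, Set.coe_toFinset]
  congr 2
  symm
  have hsub : (T.sphere x₀ (m + 1)).toFinset ⊆ (T.ball x₀ (m + 1)).toFinset :=
    Set.toFinset_subset_toFinset.2 (T.sphere_subset_ball x₀ (m + 1))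
  rw [← Finset.prod_subset hsub]
  · refine Finset.prod_congr rfl fun x hx => ?_
    rw [T.outDegree_ball_of_mem_sphere (Set.mem_toFinset.1 hx)]
  · intro x hx hx'
    rw [Set.mem_toFinset, mem_ball] at hx
    rw [Set.mem_toFinset, mem_sphere] at hx'
    rw [T.outDegree_ball_of_lt (by omega), pow_zero]

/-- The kernel of the edge above `x` is removed from an expectation by dividing by it; this makes
the spin at `x` independent of the others, with density proportional to `f x`. -/
theorem exists_lintegral_eq_mul_lintegral (hK : Measurable (Function.uncurry K.1))
    (hK0 : ∀ t u, K.1 t u ≠ 0) (hKtop : ∀ t u, K.1 t u ≠ ∞) {μ : Measure (V → Spin)}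
    {f : V → Spin → ℝ≥0∞} {C : ℝ≥0∞} {m : ℕ} (hC : C ≠ 0)
    (hf : ∀ y ∈ T.sphere x₀ (m + 1), Measurable (f y))
    (hf0 : ∀ y ∈ T.sphere x₀ (m + 1), ∀ t, f y t ≠ 0)
    (hμ : HasDensityOn volume μ (T.ball x₀ (m + 1))
      fun σ => C * T.ballWeight x₀ K f (m + 1) σ) {x : V} (hx : x ∈ T.sphere x₀ (m + 1)) :
    ∃ C' : ℝ≥0∞, C' ≠ 0 ∧ ∀ g : Spin → ℝ≥0∞, Measurable g →
      ∫⁻ σ, g (σ x) * (K.1 (σ (T.parent x₀ x)) (σ x))⁻¹ ∂μ = C' * ∫⁻ t, g t * f x t := by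
  classical
  set p := T.parent x₀ x with hp
  have hne := T.ne_root_of_mem_sphere hx
  have hadj := T.adj_parent hne
  have hpS : p ∈ T.sphere x₀ m := T.parent_mem_sphere hx
  have hpx : p ≠ x := hadj.ne
  let S : Set V := T.ball x₀ (m + 1) \ {x}
  have hxball := T.sphere_subset_ball x₀ (m + 1) hx
  have hins : T.ball x₀ (m + 1) = insert x S := by
    simp only [S, Set.insert_sdiff_singleton, Set.insert_eq_of_mem hxball]
  have hpball : p ∈ T.ball x₀ (m + 1) := by
    rw [mem_sphere] at hpS
    rw [mem_ball]; omega
  have hSfin : S.Finite := (T.ball_finite x₀ (m + 1)).sdiff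
  have hxS : x ∉ S := fun h => h.2 rfl
  let W := (T.sphere x₀ (m + 1)).toFinset
  have hxW : x ∈ W := Set.mem_toFinset.2 hx
  let R : (V → Spin) → ℝ≥0∞ := fun σ =>
    C * (T.graph.edgeWeight K S σ * ∏ y ∈ W.erase x, f y (σ y))
  have hWf : ∀ y ∈ W.erase x, y ∈ T.sphere x₀ (m + 1) := fun y hy =>
    Set.mem_toFinset.1 (Finset.mem_of_mem_erase hy)
  have hRm : Measurable R :=
    ((measurable_edgeWeight hK hSfin).mul (Finset.measurable_prod _ fun y hy =>
      (hf y (hWf y hy)).comp (measurable_pi_apply y))).const_mul _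
  have hRu : ∀ σ t, R (Function.update σ x t) = R σ := by
    intro σ t
    simp only [R]
    rw [edgeWeight_update hxS]
    congr 2
    exact Finset.prod_congr rfl fun y hy => by
      rw [Function.update_of_ne (Finset.ne_of_mem_erase hy)]
  have hR0 : ∀ σ, R σ ≠ 0 := fun σ => mul_ne_zero hC (mul_ne_zero (edgeWeight_ne_zero hK0 hSfin σ)
    (Finset.prod_ne_zero_iff.2 fun y hy => hf0 y (hWf y hy) _))
  refine ⟨∫⁻ σ, R σ ∂(refMeasure V), ?_, fun g hg => ?_⟩
  · intro h0
    rw [lintegral_eq_zero_iff hRm] at h0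
    obtain ⟨σ, hσ⟩ := h0.exists
    exact hR0 σ hσ
  have hpair : Measurable fun σ : V → Spin => (σ p, σ x) := by fun_prop
  have hKx : Measurable fun σ : V → Spin => K.1 (σ p) (σ x) := hK.comp hpair
  have hKm : Measurable fun σ : V → Spin => (K.1 (σ p) (σ x))⁻¹ := hKx.inv
  have hdep : DependsOn (fun σ : V → Spin => g (σ x) * (K.1 (σ p) (σ x))⁻¹)
      (T.ball x₀ (m + 1)) := by
    intro σ τ h
    simp only [h x hxball, h p hpball]
  rw [hμ (fun σ => g (σ x) * (K.1 (σ p) (σ x))⁻¹)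
    ((hg.comp (measurable_pi_apply x)).mul hKm) hdep]
  have hD : ∀ σ : V → Spin, g (σ x) * (K.1 (σ p) (σ x))⁻¹ *
      (C * T.ballWeight x₀ K f (m + 1) σ) = R σ * (g (σ x) * f x (σ x)) := by
    intro σ
    rw [ballWeight, hins, edgeWeight_insert hSfin ⟨hpball, hpx⟩ hxS hadj,
      ← Finset.mul_prod_erase _ _ hxW]
    · simp only [R]
      calc _ = ((K.1 (σ p) (σ x))⁻¹ * K.1 (σ p) (σ x)) * (C * (T.graph.edgeWeight K S σ *
            ∏ y ∈ W.erase x, f y (σ y)) * (g (σ x) * f x (σ x))) := by ring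
        _ = _ := by rw [ENNReal.inv_mul_cancel (hK0 _ _) (hKtop _ _), one_mul]
    · intro p' hp' hadj'
      refine T.eq_parent hne hadj' ?_
      have := hp'.1
      rw [mem_ball] at this
      rw [mem_sphere] at hx
      omega
  simp only [hD]
  have hgf : Measurable fun t => g t * f x t := hg.mul (hf x hx)
  rw [lintegral_infinitePi_update volume x (F := fun σ => R σ * (g (σ x) * f x (σ x)))
    (hRm.mul (hgf.comp (measurable_pi_apply x)))]
  simp only [hRu, Function.update_self]
  simp only [lintegral_const_mul _ hgf]
  rw [lintegral_mul_const _ hRm]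

end CayleyTree

/-! ### Moments of the odd root of the spin -/

/-- The real number `(t - 1/2)^{1/(2n+1)}` for a spin `t`. -/
noncomputable def spinRoot (n : ℕ) (t : Spin) : ℝ := oddRoot n ((t : ℝ) - 1 / 2)

theorem oddRoot_mul (n : ℕ) (x y : ℝ) : oddRoot n (x * y) = oddRoot n x * oddRoot n y := by
  have hs : Real.sign (x * y) = Real.sign x * Real.sign y := by
    rcases lt_trichotomy x 0 with hx | rfl | hx <;> rcases lt_trichotomy y 0 with hy | rfl | hy <;>
      simp [Real.sign_of_neg, Real.sign_of_pos, mul_pos_of_neg_of_neg, mul_neg_of_neg_of_pos,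
        mul_neg_of_pos_of_neg, *]
  rw [oddRoot, oddRoot, oddRoot, hs, abs_mul, Real.mul_rpow (abs_nonneg _) (abs_nonneg _)]
  ring

theorem oddRoot_neg (n : ℕ) (x : ℝ) : oddRoot n (-x) = -oddRoot n x := by
  rw [oddRoot, oddRoot, Real.sign_neg, abs_neg, neg_mul]

theorem abs_oddRoot (n : ℕ) (x : ℝ) : |oddRoot n x| = |x| ^ (1 / (2 * n + 1) : ℝ) := by
  have hq : (0 : ℝ) ^ (1 / (2 * n + 1) : ℝ) = 0 := Real.zero_rpow (by positivity)
  have habs : |(|x| ^ (1 / (2 * n + 1) : ℝ))| = |x| ^ (1 / (2 * n + 1) : ℝ) :=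
    abs_of_nonneg (Real.rpow_nonneg (abs_nonneg x) _)
  rw [oddRoot, abs_mul, habs]
  rcases lt_trichotomy x 0 with hx | rfl | hx
  · simp [Real.sign_of_neg hx]
  · rw [Real.sign_zero, abs_zero, hq, zero_mul]
  · simp [Real.sign_of_pos hx]

theorem measurable_oddRoot (n : ℕ) : Measurable (oddRoot n) := by
  have hs : Measurable Real.sign := by
    unfold Real.sign
    exact Measurable.ite measurableSet_Iio measurable_const
      (Measurable.ite measurableSet_Ioi measurable_const measurable_const)
  unfold oddRoot
  exact hs.mul (by fun_prop)

theorem measurable_spinRoot (n : ℕ) : Measurable (spinRoot n) :=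
  (measurable_oddRoot n).comp (by fun_prop)

theorem abs_spinRoot_le (n : ℕ) (t : Spin) :
    |spinRoot n t| ≤ (1 / 2 : ℝ) ^ (1 / (2 * n + 1) : ℝ) := by
  rw [spinRoot, abs_oddRoot]
  refine Real.rpow_le_rpow (abs_nonneg _) ?_ (by positivity)
  rw [abs_le]
  exact ⟨by linarith [t.2.1], by linarith [t.2.2]⟩

theorem half_rpow_mul_two_rpow (q : ℝ) : (1 / 2 : ℝ) ^ q * (2 : ℝ) ^ q = 1 := by
  rw [← Real.mul_rpow (by norm_num) (by norm_num)]
  norm_num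

theorem two_rpow_mul_self (q : ℝ) : (2 : ℝ) ^ q * (2 : ℝ) ^ q = (4 : ℝ) ^ q := by
  rw [← Real.mul_rpow (by norm_num) (by norm_num)]
  norm_num

theorem abs_spinRoot_le_one (n : ℕ) (t : Spin) : |spinRoot n t| ≤ 1 :=
  (abs_spinRoot_le n t).trans (Real.rpow_le_one (by norm_num) (by norm_num) (by positivity))

theorem one_add_mul_spinRoot_pos {n : ℕ} {y : ℝ} (hy : |y| < (2 : ℝ) ^ (1 / (2 * n + 1) : ℝ))
    (t : Spin) : 0 < 1 + y * spinRoot n t := by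
  have h : |y * spinRoot n t| < 1 := by
    rw [abs_mul, ← half_rpow_mul_two_rpow (1 / (2 * n + 1)), mul_comm]
    exact mul_lt_mul' (abs_spinRoot_le n t) hy (abs_nonneg _) (by positivity)
  linarith [(abs_lt.1 h).1]

theorem abs_mul_spinRoot_lt {n : ℕ} {θ : ℝ} (hθ : |θ| < (4 : ℝ) ^ (1 / (2 * n + 1) : ℝ))
    (t : Spin) : |θ * spinRoot n t| < (2 : ℝ) ^ (1 / (2 * n + 1) : ℝ) := by
  have h2 : 0 < (2 : ℝ) ^ (1 / (2 * n + 1) : ℝ) := by positivity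
  calc |θ * spinRoot n t| = |θ| * |spinRoot n t| := abs_mul _ _
    _ ≤ |θ| * (1 / 2 : ℝ) ^ (1 / (2 * n + 1) : ℝ) := by
      gcongr
      exact abs_spinRoot_le n t
    _ < (4 : ℝ) ^ (1 / (2 * n + 1) : ℝ) * (1 / 2 : ℝ) ^ (1 / (2 * n + 1) : ℝ) := by
      gcongr
    _ = (2 : ℝ) ^ (1 / (2 * n + 1) : ℝ) := by
      rw [← two_rpow_mul_self, mul_assoc, mul_comm (2 ^ _) ((1 / 2 : ℝ) ^ _),
        half_rpow_mul_two_rpow, mul_one]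

theorem integrable_spin {f : Spin → ℝ} (hf : Measurable f) {C : ℝ} (hC : ∀ t, |f t| ≤ C) :
    Integrable f :=
  Integrable.of_bound hf.aestronglyMeasurable C (Filter.Eventually.of_forall hC)

theorem integrable_spinRoot_pow (n i : ℕ) : Integrable fun t : Spin => spinRoot n t ^ i :=
  integrable_spin ((measurable_spinRoot n).pow_const i) (C := 1) fun t => by
    rw [abs_pow]
    exact pow_le_one₀ (abs_nonneg _) (abs_spinRoot_le_one n t)

/-- The odd moments vanish, by the symmetry `t ↦ 1 - t`. -/
theorem integral_spinRoot_pow_odd (n i : ℕ) : ∫ t : Spin, spinRoot n t ^ (2 * i + 1) = 0 := by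
  have h := unitInterval.measurePreserving_symm.integral_comp
    unitInterval.symmMeasurableEquiv.measurableEmbedding (fun t => spinRoot n t ^ (2 * i + 1))
  have h2 : ∀ t : Spin, spinRoot n (unitInterval.symm t) = -spinRoot n t := by
    intro t
    rw [spinRoot, spinRoot, ← oddRoot_neg]
    congr 1
    rw [unitInterval.coe_symm_eq]
    ring
  simp only [h2, Odd.neg_pow ⟨i, rfl⟩, integral_neg] at h
  linarith

theorem integral_spinRoot_pow_even (n i : ℕ) : ∫ t : Spin, spinRoot n t ^ (2 * i) =
    alphaEven n i := by
  have hpow : ∀ x : ℝ, oddRoot n x ^ (2 * i) = |x| ^ (2 * i / (2 * n + 1) : ℝ) := by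
    intro x
    rw [← Even.pow_abs ⟨i, by ring⟩, abs_oddRoot, ← Real.rpow_natCast,
      ← Real.rpow_mul (abs_nonneg _)]
    congr 1
    push_cast
    ring
  set r : ℝ := 2 * i / (2 * n + 1) with hr
  have hr0 : 0 ≤ r := by positivity
  have h1 : ∫ t : Spin, spinRoot n t ^ (2 * i) = ∫ x in (0 : ℝ)..1, |x - 1 / 2| ^ r := by
    rw [intervalIntegral.integral_of_le zero_le_one, ← integral_Icc_eq_integral_Ioc]
    have := unitInterval.measurePreserving_coe.integral_comp
      unitInterval.measurableEmbedding_coe (fun x : ℝ => |x - 1 / 2| ^ r)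
    rw [← this]
    exact integral_congr_ae (Filter.Eventually.of_forall fun t => hpow _)
  have hint : ∀ a b : ℝ, IntervalIntegrable (fun x : ℝ => |x| ^ r) volume a b := fun a b =>
    Continuous.intervalIntegrable (by
      exact Continuous.rpow_const continuous_abs fun _ => Or.inr hr0) a b
  have hpos : ∫ x in (0 : ℝ)..(1 / 2), |x| ^ r = (1 / 2) ^ (r + 1) / (r + 1) := by
    rw [show ∫ x in (0 : ℝ)..(1 / 2), |x| ^ r = ∫ x in (0 : ℝ)..(1 / 2), x ^ r from
      intervalIntegral.integral_congr fun x hx => by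
        rw [Set.uIcc_of_le (by norm_num)] at hx
        simp only [abs_of_nonneg hx.1], integral_rpow (Or.inl (by linarith)),
      Real.zero_rpow (by linarith), sub_zero]
  have hneg : ∫ x in (-(1 / 2) : ℝ)..0, |x| ^ r = ∫ x in (0 : ℝ)..(1 / 2), |x| ^ r := by
    have := intervalIntegral.integral_comp_neg (fun x : ℝ => |x| ^ r) (a := 0) (b := 1 / 2)
    simp only [abs_neg, neg_zero] at this
    exact this.symm
  rw [h1, intervalIntegral.integral_comp_sub_right (fun x => |x| ^ r),
    show (0 : ℝ) - 1 / 2 = -(1 / 2) by norm_num, show (1 : ℝ) - 1 / 2 = 1 / 2 by norm_num,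
    ← intervalIntegral.integral_add_adjacent_intervals (hint _ 0) (hint 0 _), hneg, hpos, alphaEven,
    ← hr, Real.rpow_add (by norm_num), Real.rpow_one]
  have hr1 : r + 1 = (2 * n + 2 * i + 1) / (2 * n + 1) := by
    rw [hr]
    field_simp
    ring
  rw [hr1]
  field_simp
  ring

/-! ### The fixed point equation -/

theorem alphaEven_pos (n i : ℕ) : 0 < alphaEven n i := by
  rw [alphaEven]
  positivity

theorem sum_range_two_mul_succ {M : Type*} [AddCommMonoid M] (f : ℕ → M) (s : ℕ) :
    ∑ i ∈ Finset.range (2 * s + 2), f i =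
      ∑ j ∈ Finset.range (s + 1), f (2 * j) + ∑ j ∈ Finset.range (s + 1), f (2 * j + 1) := by
  rw [← Finset.sum_add_distrib]
  induction s with
  | zero => simp [Finset.sum_range_succ]
  | succ s ih =>
    rw [show 2 * (s + 1) + 2 = 2 * s + 2 + 1 + 1 by ring, Finset.sum_range_succ,
      Finset.sum_range_succ, ih, Finset.sum_range_succ _ (s + 1), add_assoc]
    rfl

theorem integral_pow_mul_one_add_pow (n s m : ℕ) (y : ℝ) :
    ∫ t : Spin, spinRoot n t ^ m * (1 + y * spinRoot n t) ^ (2 * s + 1) =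
      ∑ i ∈ Finset.range (2 * s + 2), ((2 * s + 1).choose i : ℝ) * y ^ i *
        ∫ t : Spin, spinRoot n t ^ (m + i) := by
  have h : ∀ t : Spin, spinRoot n t ^ m * (1 + y * spinRoot n t) ^ (2 * s + 1) =
      ∑ i ∈ Finset.range (2 * s + 2), ((2 * s + 1).choose i : ℝ) * y ^ i *
        spinRoot n t ^ (m + i) := by
    intro t
    rw [add_comm 1, add_pow, Finset.mul_sum]
    refine Finset.sum_congr rfl fun i _ => ?_
    rw [mul_pow, one_pow, pow_add]
    ring
  simp only [h]
  rw [integral_finsetSum _ fun i _ => (integrable_spinRoot_pow n (m + i)).const_mul _]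
  simp only [integral_const_mul]

theorem integral_one_add_pow (n s : ℕ) (y : ℝ) :
    ∫ t : Spin, (1 + y * spinRoot n t) ^ (2 * s + 1) =
      ∑ j ∈ Finset.range (s + 1), ((2 * s + 1).choose (2 * j) : ℝ) * y ^ (2 * j) *
        alphaEven n j := by
  have h := integral_pow_mul_one_add_pow n s 0 y
  simp only [pow_zero, one_mul, zero_add] at h
  rw [h, sum_range_two_mul_succ]
  simp only [integral_spinRoot_pow_even, integral_spinRoot_pow_odd, mul_zero,
    Finset.sum_const_zero, add_zero]

theorem integral_spinRoot_mul_one_add_pow (n s : ℕ) (y : ℝ) :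
    ∫ t : Spin, spinRoot n t * (1 + y * spinRoot n t) ^ (2 * s + 1) =
      ∑ j ∈ Finset.range (s + 1), ((2 * s + 1).choose (2 * j + 1) : ℝ) * y ^ (2 * j + 1) *
        alphaEven n (j + 1) := by
  have h := integral_pow_mul_one_add_pow n s 1 y
  simp only [pow_one] at h
  rw [h, sum_range_two_mul_succ]
  have h1 : ∀ j, 1 + 2 * j = 2 * j + 1 := fun j => by ring
  have h2 : ∀ j, 1 + (2 * j + 1) = 2 * (j + 1) := fun j => by ring
  simp only [h1, h2, integral_spinRoot_pow_even, integral_spinRoot_pow_odd, mul_zero,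
    Finset.sum_const_zero, zero_add]

theorem integral_one_add_pow_pos (n s : ℕ) (y : ℝ) :
    0 < ∫ t : Spin, (1 + y * spinRoot n t) ^ (2 * s + 1) := by
  rw [integral_one_add_pow, Finset.sum_range_succ']
  have h : 0 ≤ ∑ j ∈ Finset.range s, ((2 * s + 1).choose (2 * (j + 1)) : ℝ) * y ^ (2 * (j + 1)) *
      alphaEven n (j + 1) := by
    refine Finset.sum_nonneg fun j _ => ?_
    have := (alphaEven_pos n (j + 1)).le
    rw [pow_mul]
    positivity
  have := alphaEven_pos n 0
  simp only [mul_zero, Nat.choose_zero_right, pow_zero, Nat.cast_one, one_mul]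
  linarith

/-- The polynomial in `z = y ^ 2` whose positive zeros give the nontrivial fixed points. -/
noncomputable def fixedPointPoly (n s : ℕ) (θ z : ℝ) : ℝ :=
  ∑ j ∈ Finset.range (s + 1), z ^ j * (betaOdd n s j * (thetaOdd n s j - θ))

theorem betaOdd_pos {n s j : ℕ} (hj : j ≤ s) : 0 < betaOdd n s j := by
  rw [betaOdd]
  have := alphaEven_pos n (j + 1)
  have : 0 < (2 * s + 1).choose (2 * j + 1) := Nat.choose_pos (by omega)
  positivity

theorem betaOdd_mul_thetaOdd {n s j : ℕ} (hj : j ≤ s) :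
    betaOdd n s j * thetaOdd n s j = ((2 * s + 1).choose (2 * j) : ℝ) * alphaEven n j := by
  have hsj : (0 : ℝ) < 2 * s - 2 * j + 1 := by
    have : (j : ℝ) ≤ s := by exact_mod_cast hj
    linarith
  have hch : ((2 * s + 1).choose (2 * j + 1) : ℝ) * (2 * j + 1) =
      ((2 * s + 1).choose (2 * j) : ℝ) * (2 * s - 2 * j + 1) := by
    have := Nat.choose_succ_right_eq (2 * s + 1) (2 * j)
    have h2 : ((2 * s + 1 - 2 * j : ℕ) : ℝ) = 2 * s - 2 * j + 1 := by
      rw [Nat.cast_sub (by omega)]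
      push_cast
      ring
    rw [← h2]
    exact_mod_cast this
  have hpow : (1 / 2 : ℝ) ^ (2 * (j + 1 : ℕ) / (2 * n + 1) : ℝ) * (4 : ℝ) ^ (1 / (2 * n + 1) : ℝ) =
      (1 / 2 : ℝ) ^ (2 * j / (2 * n + 1) : ℝ) := by
    have h4 : (4 : ℝ) ^ (1 / (2 * n + 1) : ℝ) = (1 / 2 : ℝ) ^ (-(2 / (2 * n + 1)) : ℝ) := by
      rw [show (4 : ℝ) = (1 / 2) ^ (-2 : ℝ) by
        rw [Real.rpow_neg (by norm_num)]; norm_num, ← Real.rpow_mul (by norm_num)]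
      congr 1
      ring
    rw [h4, ← Real.rpow_add (by norm_num)]
    congr 1
    push_cast
    ring
  rw [betaOdd, thetaOdd, alphaEven, alphaEven, ← hpow]
  push_cast at hch ⊢
  have hd : (0 : ℝ) < 2 * n + 2 * j + 1 := by positivity
  have hd' : (0 : ℝ) < 2 * n + 2 * (j + 1) + 1 := by positivity
  have hc2 : ((2 * s + 1).choose (2 * j) : ℝ) =
      ((2 * s + 1).choose (2 * j + 1) : ℝ) * (2 * j + 1) / (2 * s - 2 * j + 1) := by
    rw [eq_div_iff hsj.ne', hch]
  rw [hc2]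
  field_simp
  ring

/-- The moment form of the fixed point equation. -/
theorem mul_integral_sub_integral (n s : ℕ) (θ c : ℝ) :
    c * (∫ t : Spin, (1 + θ * c * spinRoot n t) ^ (2 * s + 1)) -
      ∫ t : Spin, spinRoot n t * (1 + θ * c * spinRoot n t) ^ (2 * s + 1) =
    c * fixedPointPoly n s θ ((θ * c) ^ 2) := by
  rw [integral_one_add_pow, integral_spinRoot_mul_one_add_pow, fixedPointPoly, Finset.mul_sum,
    Finset.mul_sum, ← Finset.sum_sub_distrib]
  refine Finset.sum_congr rfl fun j hj => ?_
  rw [mul_sub (betaOdd n s j), betaOdd_mul_thetaOdd (by simpa [Nat.lt_succ_iff] using hj), betaOdd,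
    ← pow_mul, pow_succ (θ * c) (2 * j)]
  ring

/-- The sequence `θ_{2i+1}` is strictly increasing, so that the coefficients of the polynomial
change sign at most once. -/
theorem thetaOdd_lt {n s i j : ℕ} (hij : i < j) (hj : j ≤ s) : thetaOdd n s i < thetaOdd n s j := by
  have hij' : (i : ℝ) + 1 ≤ j := by exact_mod_cast hij
  have hj' : (j : ℝ) ≤ s := by exact_mod_cast hj
  have hi0 : (0 : ℝ) ≤ i := Nat.cast_nonneg i
  have hn0 : (0 : ℝ) ≤ n := Nat.cast_nonneg n
  have h4 : 0 < (4 : ℝ) ^ (1 / (2 * n + 1) : ℝ) := by positivity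
  have h1 : (2 * i + 1 : ℝ) * (2 * n + 2 * j + 1) ≤ (2 * j + 1) * (2 * n + 2 * i + 1) := by
    nlinarith [mul_nonneg hn0 (by linarith : (0 : ℝ) ≤ j - i)]
  have h2 : (2 * n + 2 * i + 3 : ℝ) * (2 * s - 2 * j + 1) <
      (2 * n + 2 * j + 3) * (2 * s - 2 * i + 1) :=
    mul_lt_mul'' (by linarith) (by linarith) (by linarith) (by linarith)
  have h3 : ((2 * i + 1 : ℝ) * (2 * n + 2 * j + 1)) *
      ((2 * n + 2 * i + 3) * (2 * s - 2 * j + 1)) <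
      ((2 * j + 1) * (2 * n + 2 * i + 1)) * ((2 * n + 2 * j + 3) * (2 * s - 2 * i + 1)) :=
    mul_lt_mul' h1 h2 (mul_nonneg (by linarith) (by linarith)) (by positivity)
  rw [thetaOdd, thetaOdd, div_lt_div_iff₀ (mul_pos (by linarith) (by linarith))
    (mul_pos (by linarith) (by linarith))]
  nlinarith [mul_lt_mul_of_pos_left h3 h4]

theorem thetaOdd_le {n s i j : ℕ} (hij : i ≤ j) (hj : j ≤ s) : thetaOdd n s i ≤ thetaOdd n s j := by
  rcases hij.eq_or_lt with rfl | h
  · exact le_rfl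
  · exact (thetaOdd_lt h hj).le

theorem thetaOdd_zero_pos (n s : ℕ) : 0 < thetaOdd n s 0 := by
  rw [thetaOdd]
  simp only [Nat.cast_zero, mul_zero, sub_zero]
  positivity

/-- The polynomial has at most one positive zero: divided by `z ^ i`, where `i` is the place at which
its coefficients become positive, it is strictly increasing on the positive half-line. -/
theorem fixedPointPoly_ne_zero_of_lt {n s : ℕ} {θ z w : ℝ} (h0 : thetaOdd n s 0 < θ) (hz : 0 < z)
    (hzw : z < w) (hPz : fixedPointPoly n s θ z = 0) : fixedPointPoly n s θ w ≠ 0 := by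
  intro hPw
  obtain ⟨i, hi⟩ : ∃ i, ∀ j ≤ s, (j < i → thetaOdd n s j ≤ θ) ∧ (i ≤ j → θ < thetaOdd n s j) := by
    by_cases h : ∃ j, j ≤ s ∧ θ < thetaOdd n s j
    · classical
      refine ⟨Nat.find h, fun j hj => ⟨fun hlt => ?_, fun hle => ?_⟩⟩
      · by_contra hcon
        exact Nat.find_min h hlt ⟨hj, not_le.1 hcon⟩
      · exact (Nat.find_spec h).2.trans_le (thetaOdd_le hle hj)
    · refine ⟨s + 1, fun j hj => ⟨fun _ => ?_, fun hle => by omega⟩⟩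
      by_contra hcon
      exact h ⟨j, hj, not_le.1 hcon⟩
  have hi0 : 0 < i := by
    by_contra hcon
    exact lt_asymm h0 ((hi 0 (Nat.zero_le s)).2 (by omega))
  have hw : 0 < w := hz.trans hzw
  have hsum : 0 < ∑ j ∈ Finset.range (s + 1),
      (z ^ i * w ^ j - w ^ i * z ^ j) * (betaOdd n s j * (thetaOdd n s j - θ)) := by
    refine Finset.sum_pos' (fun j hj => ?_) ⟨0, by simp, ?_⟩
    · have hjs : j ≤ s := by simpa [Nat.lt_succ_iff] using hj
      have hb := (betaOdd_pos (n := n) hjs).le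
      rcases lt_or_ge j i with hji | hji
      · have h1 := (hi j hjs).1 hji
        have h2 : z ^ (i - j) ≤ w ^ (i - j) := by gcongr
        have h3 : z ^ i * w ^ j - w ^ i * z ^ j ≤ 0 := by
          rw [← Nat.sub_add_cancel hji.le, pow_add, pow_add]
          nlinarith [mul_le_mul_of_nonneg_right h2 (by positivity : 0 ≤ z ^ j * w ^ j)]
        exact mul_nonneg_of_nonpos_of_nonpos h3 (mul_nonpos_of_nonneg_of_nonpos hb (by linarith))
      · have h1 := (hi j hjs).2 hji
        have h2 : z ^ (j - i) ≤ w ^ (j - i) := by gcongr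
        have h3 : 0 ≤ z ^ i * w ^ j - w ^ i * z ^ j := by
          rw [← Nat.sub_add_cancel hji, pow_add, pow_add]
          nlinarith [mul_le_mul_of_nonneg_right h2 (by positivity : 0 ≤ z ^ i * w ^ i)]
        exact mul_nonneg h3 (mul_nonneg hb (by linarith))
    · have hb := betaOdd_pos (n := n) (Nat.zero_le s)
      have h2 : z ^ i < w ^ i := pow_lt_pow_left₀ hzw hz.le hi0.ne'
      simp only [pow_zero, mul_one]
      exact mul_pos_of_neg_of_neg (by linarith) (mul_neg_of_pos_of_neg hb (by linarith))
  have heq : ∑ j ∈ Finset.range (s + 1),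
      (z ^ i * w ^ j - w ^ i * z ^ j) * (betaOdd n s j * (thetaOdd n s j - θ)) =
      z ^ i * fixedPointPoly n s θ w - w ^ i * fixedPointPoly n s θ z := by
    rw [fixedPointPoly, fixedPointPoly, Finset.mul_sum, Finset.mul_sum, ← Finset.sum_sub_distrib]
    exact Finset.sum_congr rfl fun j _ => by ring
  rw [heq, hPz, hPw] at hsum
  simp at hsum

theorem fixedPointPoly_four_rpow (n s : ℕ) (θ : ℝ) :
    fixedPointPoly n s θ ((4 : ℝ) ^ (1 / (2 * n + 1) : ℝ)) =
      (thetaAverage n s - θ) * ∑ i ∈ Finset.range (s + 1),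
        (2 : ℝ) ^ (2 * i / (2 * n + 1) : ℝ) * betaOdd n s i := by
  have hpos : 0 < ∑ i ∈ Finset.range (s + 1),
      (2 : ℝ) ^ (2 * i / (2 * n + 1) : ℝ) * betaOdd n s i := by
    refine Finset.sum_pos (fun j hj => ?_) ⟨0, by simp⟩
    have hjs : j ≤ s := by simpa [Nat.lt_succ_iff] using hj
    have := betaOdd_pos (n := n) hjs
    positivity
  have hpow : ∀ j : ℕ, ((4 : ℝ) ^ (1 / (2 * n + 1) : ℝ)) ^ j =
      (2 : ℝ) ^ (2 * j / (2 * n + 1) : ℝ) := by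
    intro j
    rw [show (4 : ℝ) = 2 ^ (2 : ℝ) by norm_num, ← Real.rpow_mul (by norm_num), ← Real.rpow_natCast,
      ← Real.rpow_mul (by norm_num)]
    congr 1
    ring
  rw [thetaAverage, sub_mul, div_mul_cancel₀ _ hpos.ne', fixedPointPoly, Finset.mul_sum,
    ← Finset.sum_sub_distrib]
  refine Finset.sum_congr rfl fun j _ => ?_
  rw [hpow]
  ring

/-- The average `θ̄` is at least `4^{1/(2n+1)}`: at `y = 2^{1/(2n+1)}` the law `(1 + y ρ)^{2s+1}` is
nonnegative, so the mean of `ρ` under it is at most `(1/2)^{1/(2n+1)}`. -/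
theorem four_rpow_le_thetaAverage (n s : ℕ) :
    (4 : ℝ) ^ (1 / (2 * n + 1) : ℝ) ≤ thetaAverage n s := by
  set Q : ℝ := (4 : ℝ) ^ (1 / (2 * n + 1) : ℝ) with hQ
  set y : ℝ := (2 : ℝ) ^ (1 / (2 * n + 1) : ℝ) with hy
  set c : ℝ := (1 / 2 : ℝ) ^ (1 / (2 * n + 1) : ℝ) with hc
  have hcy : c * y = 1 := half_rpow_mul_two_rpow _
  have hyy : y * y = Q := two_rpow_mul_self _
  have hc0 : 0 < c := by positivity
  have hy0 : 0 < y := by positivity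
  have hQc : Q * c = y := by rw [← hyy, mul_assoc, mul_comm y c, hcy, mul_one]
  have hid := mul_integral_sub_integral n s Q c
  rw [hQc, sq, hyy, hQ, fixedPointPoly_four_rpow, ← hQ] at hid
  have hm : Measurable fun t : Spin => (1 + y * spinRoot n t) ^ (2 * s + 1) :=
    (((measurable_spinRoot n).const_mul y).const_add 1).pow_const _
  have hnn : ∀ t : Spin, 0 ≤ 1 + y * spinRoot n t := by
    intro t
    have := (abs_le.1 (abs_spinRoot_le n t)).1
    nlinarith
  have hle : ∀ t : Spin, 1 + y * spinRoot n t ≤ 2 := by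
    intro t
    have := (abs_le.1 (abs_spinRoot_le n t)).2
    nlinarith
  have hb : ∀ t : Spin, |(1 + y * spinRoot n t) ^ (2 * s + 1)| ≤ 2 ^ (2 * s + 1) := by
    intro t
    rw [abs_of_nonneg (pow_nonneg (hnn t) _)]
    exact pow_le_pow_left₀ (hnn t) (hle t) _
  have h1 : Integrable fun t : Spin => (1 + y * spinRoot n t) ^ (2 * s + 1) := integrable_spin hm hb
  have h2 : Integrable fun t : Spin => spinRoot n t * (1 + y * spinRoot n t) ^ (2 * s + 1) :=
    integrable_spin ((measurable_spinRoot n).mul hm) (C := 1 * 2 ^ (2 * s + 1)) fun t => by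
      rw [abs_mul]
      exact mul_le_mul (abs_spinRoot_le_one n t) (hb t) (abs_nonneg _) zero_le_one
  have h3 : ∫ t : Spin, spinRoot n t * (1 + y * spinRoot n t) ^ (2 * s + 1) ≤
      c * ∫ t : Spin, (1 + y * spinRoot n t) ^ (2 * s + 1) := by
    rw [← integral_const_mul]
    refine integral_mono h2 (h1.const_mul c) fun t => ?_
    exact mul_le_mul_of_nonneg_right ((le_abs_self _).trans (abs_spinRoot_le n t))
      (pow_nonneg (hnn t) _)
  have hpos : 0 < ∑ i ∈ Finset.range (s + 1),
      (2 : ℝ) ^ (2 * i / (2 * n + 1) : ℝ) * betaOdd n s i := by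
    refine Finset.sum_pos (fun j hj => ?_) ⟨0, by simp⟩
    have hjs : j ≤ s := by simpa [Nat.lt_succ_iff] using hj
    have := betaOdd_pos (n := n) hjs
    positivity
  have h4 : 0 ≤ c * ((thetaAverage n s - Q) * ∑ i ∈ Finset.range (s + 1),
      (2 : ℝ) ^ (2 * i / (2 * n + 1) : ℝ) * betaOdd n s i) := by
    rw [← hid]
    linarith
  have h5 := nonneg_of_mul_nonneg_left (nonneg_of_mul_nonneg_right h4 hc0) hpos
  linarith

theorem four_rpow_lt_thetaOdd_last {n s : ℕ} :
    (4 : ℝ) ^ (1 / (2 * n + 1) : ℝ) < thetaOdd n s s := by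
  have h4 : 0 < (4 : ℝ) ^ (1 / (2 * n + 1) : ℝ) := by positivity
  rw [thetaOdd, lt_div_iff₀ (by rw [sub_self, zero_add, one_mul]; positivity), sub_self, zero_add,
    one_mul]
  have hs0 : (0 : ℝ) ≤ s := Nat.cast_nonneg s
  have hn0 : (0 : ℝ) ≤ n := Nat.cast_nonneg n
  have : (2 * n + 2 * s + 1 : ℝ) < (2 * s + 1) * (2 * n + 2 * s + 3) := by
    nlinarith [mul_nonneg hs0 hn0, mul_nonneg hs0 hs0]
  nlinarith

/-- The means `c` of the odd root of the spin under the law proportional to `(1 + θ c ρ)^{2s+1}`,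
for which this law is positive on `[0,1]`. -/
def fixedPoints (n s : ℕ) (θ : ℝ) : Set ℝ :=
  {c | |θ * c| < (2 : ℝ) ^ (1 / (2 * n + 1) : ℝ) ∧
    c * (∫ t : Spin, (1 + θ * c * spinRoot n t) ^ (2 * s + 1)) =
      ∫ t : Spin, spinRoot n t * (1 + θ * c * spinRoot n t) ^ (2 * s + 1)}

theorem mem_fixedPoints {n s : ℕ} {θ c : ℝ} : c ∈ fixedPoints n s θ ↔
    |θ * c| < (2 : ℝ) ^ (1 / (2 * n + 1) : ℝ) ∧
      (c = 0 ∨ fixedPointPoly n s θ ((θ * c) ^ 2) = 0) := by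
  rw [fixedPoints, Set.mem_ofPred_eq, ← sub_eq_zero (a := c * _), mul_integral_sub_integral,
    mul_eq_zero]

theorem fixedPoints_eq_zero {n s : ℕ} (hs : 1 ≤ s) {θ : ℝ} (h : θ ≤ thetaOdd n s 0) :
    fixedPoints n s θ = {0} := by
  ext c
  rw [mem_fixedPoints, Set.mem_singleton_iff]
  constructor
  · rintro ⟨-, hc | hP⟩
    · exact hc
    · by_contra hc
      refine (ne_of_gt ?_) hP
      have hterm : ∀ j ∈ Finset.range (s + 1),
          0 ≤ ((θ * c) ^ 2) ^ j * (betaOdd n s j * (thetaOdd n s j - θ)) := by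
        intro j hj
        have hjs : j ≤ s := by simpa [Nat.lt_succ_iff] using hj
        have := (betaOdd_pos (n := n) hjs).le
        have h2 : 0 ≤ thetaOdd n s j - θ := by linarith [thetaOdd_le (n := n) (Nat.zero_le j) hjs]
        positivity
      rcases h.lt_or_eq with hlt | heq
      · refine Finset.sum_pos' hterm ⟨0, by simp, ?_⟩
        have := betaOdd_pos (n := n) (Nat.zero_le s)
        have h2 : 0 < thetaOdd n s 0 - θ := by linarith
        positivity
      · refine Finset.sum_pos' hterm ⟨s, by simp, ?_⟩
        have := betaOdd_pos (n := n) (le_refl s)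
        have h2 : 0 < thetaOdd n s s - θ := by linarith [thetaOdd_lt (n := n) (i := 0) hs le_rfl]
        have hθ : θ ≠ 0 := by rw [heq]; exact (thetaOdd_zero_pos n s).ne'
        have : 0 < (θ * c) ^ 2 := by positivity
        positivity
  · rintro rfl
    refine ⟨?_, Or.inl rfl⟩
    rw [mul_zero, abs_zero]
    positivity

theorem ncard_fixedPoints_eq_three {n s : ℕ} {θ : ℝ} (h : thetaOdd n s 0 < θ)
    (h' : θ < thetaAverage n s) : (fixedPoints n s θ).ncard = 3 := by
  have hθ : 0 < θ := (thetaOdd_zero_pos n s).trans h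
  set Q : ℝ := (4 : ℝ) ^ (1 / (2 * n + 1) : ℝ) with hQ
  have hQ0 : 0 < Q := by positivity
  have hcont : Continuous (fixedPointPoly n s θ) := by
    unfold fixedPointPoly
    fun_prop
  have hP0 : fixedPointPoly n s θ 0 < 0 := by
    rw [fixedPointPoly, Finset.sum_range_succ', Finset.sum_eq_zero fun j _ => by simp]
    simp only [pow_zero, one_mul, zero_add]
    exact mul_neg_of_pos_of_neg (betaOdd_pos (Nat.zero_le s)) (by linarith)
  have hPQ : 0 < fixedPointPoly n s θ Q := by
    rw [hQ, fixedPointPoly_four_rpow]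
    refine mul_pos (by linarith) (Finset.sum_pos (fun j hj => ?_) ⟨0, by simp⟩)
    have hjs : j ≤ s := by simpa [Nat.lt_succ_iff] using hj
    have := betaOdd_pos (n := n) hjs
    positivity
  obtain ⟨z, ⟨hz0, hzQ⟩, hz⟩ :=
    intermediate_value_Ioo hQ0.le hcont.continuousOn (Set.mem_Ioo.2 ⟨hP0, hPQ⟩)
  have huniq : ∀ w, 0 ≤ w → fixedPointPoly n s θ w = 0 → w = z := by
    intro w hw hPw
    have hw0 : 0 < w := lt_of_le_of_ne hw (by rintro rfl; exact hP0.ne hPw)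
    rcases lt_trichotomy w z with hlt | heq | hgt
    · exact absurd hz (fixedPointPoly_ne_zero_of_lt h hw0 hlt hPw)
    · exact heq
    · exact absurd hPw (fixedPointPoly_ne_zero_of_lt h hz0 hgt hz)
  have hc0 : 0 < √z / θ := div_pos (Real.sqrt_pos.2 hz0) hθ
  have hset : fixedPoints n s θ = {0, √z / θ, -(√z / θ)} := by
    have hlt : √z < (2 : ℝ) ^ (1 / (2 * n + 1) : ℝ) := by
      rw [Real.sqrt_lt' (by positivity), sq, two_rpow_mul_self]
      exact hzQ
    ext c
    rw [mem_fixedPoints, Set.mem_insert_iff, Set.mem_insert_iff, Set.mem_singleton_iff]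
    constructor
    · rintro ⟨-, hc | hc⟩
      · exact Or.inl hc
      · right
        have h1 := huniq _ (sq_nonneg _) hc
        rw [← Real.sq_sqrt hz0.le, sq_eq_sq_iff_eq_or_eq_neg] at h1
        refine h1.imp (fun h1 => ?_) fun h1 => ?_
        · rw [← h1]; field_simp
        · rw [← neg_div, ← h1]; field_simp
    · rintro (rfl | rfl | rfl)
      · refine ⟨?_, Or.inl rfl⟩
        rw [mul_zero, abs_zero]
        positivity
      · rw [mul_div_cancel₀ _ hθ.ne', abs_of_nonneg (Real.sqrt_nonneg z), Real.sq_sqrt hz0.le]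
        exact ⟨hlt, Or.inr hz⟩
      · rw [mul_neg, mul_div_cancel₀ _ hθ.ne', abs_neg, abs_of_nonneg (Real.sqrt_nonneg z), neg_sq,
          Real.sq_sqrt hz0.le]
        exact ⟨hlt, Or.inr hz⟩
  rw [hset]
  rw [Set.ncard_eq_three]
  exact ⟨0, √z / θ, -(√z / θ), hc0.ne, fun h => by linarith, fun h => by linarith, rfl⟩

/-! ### Gibbs measures from boundary laws -/

namespace CayleyTree

open SimpleGraph

variable {k : ℕ} {V : Type*} (T : CayleyTree k V) {x₀ : V} {K : SymmKernel} {L : Spin → ℝ≥0∞}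
  {A M : ℝ≥0∞}

theorem walkConnectedOn_ball (m : ℕ) :
    T.graph.WalkConnectedOn ((T.ball x₀ m).toFinset : Set V) := by
  rw [Set.coe_toFinset]
  exact T.isTree.walkConnectedOn_ball x₀ m

theorem nonempty_ball (m : ℕ) : (T.ball x₀ m).toFinset.Nonempty :=
  ⟨x₀, Set.mem_toFinset.2 (T.root_mem_ball m)⟩

/-- A boundary law gives a probability measure whose marginals on all finite connected sets are the
splitting densities. -/
theorem exists_hasDensityOn_splittingDensity (x₀ : V) (hL : IsBoundaryLaw K k L A)
    (hM : M * A⁻¹ * ∫⁻ t, L t ^ (k + 1) = 1) :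
    ∃ μ : Measure (V → Spin), IsProbabilityMeasure μ ∧ ∀ S : Finset V,
      T.graph.WalkConnectedOn (S : Set V) → S.Nonempty →
        HasDensityOn volume μ S (T.graph.splittingDensity K L A M S) := by
  classical
  have := T.countable x₀
  obtain ⟨μ, hμ, hd⟩ := exists_hasDensityOn
    (S := fun m => ((T.ball x₀ m).toFinset : Set V))
    (D := fun m => T.graph.splittingDensity K L A M (T.ball x₀ m).toFinset)
    (fun m => measurable_splittingDensity hL.measurable_kernel hL.measurable A M _)
    (fun m => lintegral_splittingDensity T.ncard_neighborSet T.isTree hL hM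
      (T.walkConnectedOn_ball m) (T.nonempty_ball m))
    (fun m m' hmm' F hF hFS => lintegral_mul_splittingDensity_of_subset T.ncard_neighborSet T.isTree
      hL (T.walkConnectedOn_ball m) (T.walkConnectedOn_ball m') (T.nonempty_ball m)
      (Set.toFinset_subset_toFinset.2 fun x hx => le_trans hx hmm') hF hFS)
    fun m => Finset.finite_toSet _
  refine ⟨μ, hμ, fun S hS hne F hF hFS => ?_⟩
  obtain ⟨m, hm⟩ := T.exists_subset_ball (x₀ := x₀) S
  rw [← Set.coe_toFinset (T.ball x₀ m), Finset.coe_subset] at hm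
  rw [hd m F hF (hFS.mono (Finset.coe_subset.2 hm))]
  exact lintegral_mul_splittingDensity_of_subset T.ncard_neighborSet T.isTree hL hS
    (T.walkConnectedOn_ball m) hne hm hF hFS

/-- The splitting densities do not refer to the root, so a measure with these marginals is
translation invariant. -/
theorem isTranslationInvariant_of_hasDensityOn (x₀ : V) (hL : IsBoundaryLaw K k L A)
    {μ : Measure (V → Spin)} [IsProbabilityMeasure μ]
    (hμ : ∀ S : Finset V, T.graph.WalkConnectedOn (S : Set V) → S.Nonempty →
      HasDensityOn volume μ S (T.graph.splittingDensity K L A M S)) :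
    T.IsTranslationInvariant μ := by
  classical
  intro φ
  have hφm : Measurable fun (σ : V → Spin) (x : V) => σ (φ x) := by fun_prop
  have : IsProbabilityMeasure (μ.map fun (σ : V → Spin) (x : V) => σ (φ x)) :=
    Measure.isProbabilityMeasure_map hφm.aemeasurable
  refine HasDensityOn.ext (ν := volume) (S := fun m => ((T.ball x₀ m).toFinset : Set V))
    (D := fun m => T.graph.splittingDensity K L A M (T.ball x₀ m).toFinset) ?_ ?_
    fun m => hμ _ (T.walkConnectedOn_ball m) (T.nonempty_ball m)
  · intro I
    obtain ⟨m, hm⟩ := T.exists_subset_ball (x₀ := x₀) I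
    exact ⟨m, by simpa using hm⟩
  · intro m F hF hFS
    set S := (T.ball x₀ m).toFinset with hS
    have hconn : T.graph.WalkConnectedOn ((S.image φ : Finset V) : Set V) := by
      rw [Finset.coe_image]
      exact (T.walkConnectedOn_ball m).image φ.toHom
    have hdep : DependsOn (fun σ : V → Spin => F fun x => σ (φ x))
        ((S.image φ : Finset V) : Set V) := by
      intro σ τ h
      refine hFS fun x hx => h (φ x) ?_
      rw [Finset.coe_image]
      exact ⟨x, hx, rfl⟩
    rw [lintegral_map hF hφm, hμ _ hconn ((T.nonempty_ball m).image φ)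
      (fun σ => F fun x => σ (φ x)) (hF.comp hφm) hdep]
    simp only [splittingDensity_image]
    have hm := hF.mul
      (measurable_splittingDensity (G := T.graph) hL.measurable_kernel hL.measurable A M S)
    have h := lintegral_map (μ := refMeasure V) hm hφm
    rw [show (refMeasure V).map (fun (σ : V → Spin) (x : V) => σ (φ x)) = refMeasure V from
      map_comp_infinitePi volume φ.toEquiv] at h
    exact h.symm

/-! ### Weights and densities on configurations on a ball -/

variable {J β : ℝ} {ξ : {ξ : Spin → Spin → ℝ // ∀ t u, ξ t u = ξ u t}} {h : V → Spin → ℝ} {m : ℕ}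

/-- The boundary factors `exp h` of the model. -/
noncomputable def boundaryFactor (h : V → Spin → ℝ) (x : V) (t : Spin) : ℝ≥0∞ :=
  ENNReal.ofReal (Real.exp (h x t))

theorem exists_extension (S : Set V) (τ : S → Spin) :
    ∃ σ : V → Spin, (fun x : S => σ x) = τ := by
  classical
  exact ⟨fun x => if hx : x ∈ S then τ ⟨x, hx⟩ else 0, by ext x; simp⟩

theorem measurable_weight (hK : Measurable (Function.uncurry (boltzmannKernel J β ξ).1))
    (hh : ∀ x ∈ T.sphere x₀ m, Measurable (h x)) : Measurable (T.weight x₀ J β ξ h m) := by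
  obtain ⟨F, hF, hFe⟩ := (T.ballWeight_dependsOn (x₀ := x₀) (K := boltzmannKernel J β ξ)
    (boundaryFactor h) m).exists_measurable_comp_restrict
    (T.measurable_ballWeight hK fun x hx =>
      (Real.measurable_exp.comp (hh x hx)).ennreal_ofReal)
  have : T.weight x₀ J β ξ h m = F := by
    funext τ
    obtain ⟨σ, rfl⟩ := exists_extension _ τ
    rw [← hFe, weight_eq_ballWeight]
    rfl
  rwa [this]

theorem partitionFunction_eq (hK : Measurable (Function.uncurry (boltzmannKernel J β ξ).1))
    (hh : ∀ x ∈ T.sphere x₀ m, Measurable (h x)) :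
    T.partitionFunction x₀ J β ξ h m = ∫⁻ σ, T.ballWeight x₀ (boltzmannKernel J β ξ)
      (boundaryFactor h) m σ ∂(refMeasure V) := by
  rw [partitionFunction, volume_pi, ← map_restrict_infinitePi volume (T.ball x₀ m),
    lintegral_map (T.measurable_weight hK hh) (by fun_prop)]
  exact lintegral_congr fun σ => T.weight_eq_ballWeight J β ξ h m σ

theorem density_eq (σ : V → Spin) : T.density x₀ J β ξ h m (fun x => σ x) =
    (T.partitionFunction x₀ J β ξ h m)⁻¹ *
      T.ballWeight x₀ (boltzmannKernel J β ξ) (boundaryFactor h) m σ := by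
  rw [density, weight_eq_ballWeight]
  rfl

theorem hasDensityOn_iff_marginal (hK : Measurable (Function.uncurry (boltzmannKernel J β ξ).1))
    (hh : ∀ x ∈ T.sphere x₀ m, Measurable (h x)) {μ : Measure (V → Spin)} :
    HasDensityOn volume μ (T.ball x₀ m) (fun σ => (T.partitionFunction x₀ J β ξ h m)⁻¹ *
        T.ballWeight x₀ (boltzmannKernel J β ξ) (boundaryFactor h) m σ) ↔
      μ.map (fun (σ : V → Spin) (x : T.ball x₀ m) => σ x) =
        (volume : Measure (T.ball x₀ m → Spin)).withDensity (T.density x₀ J β ξ h m) := by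
  have hd : Measurable (T.density x₀ J β ξ h m) := (T.measurable_weight hK hh).const_mul _
  rw [volume_pi, ← hasDensityOn_iff_map volume μ (T.ball x₀ m) hd]
  simp only [density_eq]

theorem lintegral_density_concat (hK : Measurable (Function.uncurry (boltzmannKernel J β ξ).1))
    {L : Spin → ℝ≥0∞} {A : V → ℝ≥0∞} (hh : ∀ x ∈ T.sphere x₀ (m + 2), Measurable (h x))
    (hfL : ∀ y ∈ T.sphere x₀ (m + 2), ∀ s,
      ∫⁻ t, (boltzmannKernel J β ξ).1 s t * boundaryFactor h y t = A y * L s) (σ : V → Spin) :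
    ∫⁻ ω, T.density x₀ J β ξ h (m + 2) (T.concat x₀ (m + 1) (fun x => σ x) ω) =
      (T.partitionFunction x₀ J β ξ h (m + 2))⁻¹ * (∏ y ∈ (T.sphere x₀ (m + 2)).toFinset, A y) *
        T.ballWeight x₀ (boltzmannKernel J β ξ) (fun _ t => L t ^ k) (m + 1) σ := by
  have hfm : ∀ y ∈ T.sphere x₀ (m + 2), Measurable (boundaryFactor h y) := fun y hy =>
    (Real.measurable_exp.comp (hh y hy)).ennreal_ofReal
  have hglue : Measurable fun ω => T.glue x₀ (m + 2) σ ω := by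
    refine measurable_pi_lambda _ fun x => ?_
    by_cases hx : x ∈ T.sphere x₀ (m + 2)
    · simp only [glue, hx, dif_pos]; fun_prop
    · simp only [glue, hx, dif_neg, not_false_eq_true]; exact measurable_const
  have hc : ∀ ω, T.density x₀ J β ξ h (m + 2) (T.concat x₀ (m + 1) (fun x => σ x) ω) =
      (T.partitionFunction x₀ J β ξ h (m + 2))⁻¹ * T.ballWeight x₀ (boltzmannKernel J β ξ)
        (boundaryFactor h) (m + 2) (T.glue x₀ (m + 2) σ ω) := by
    intro ω
    rw [concat_eq_glue, density_eq]
  have hm : Measurable fun ω => T.ballWeight x₀ (boltzmannKernel J β ξ) (boundaryFactor h) (m + 2)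
      (T.glue x₀ (m + 2) σ ω) := (T.measurable_ballWeight hK hfm).comp hglue
  rw [lintegral_congr hc, lintegral_const_mul _ hm,
    T.lintegral_ballWeight_glue hK hfm hfL, mul_assoc]

/-- The boundary law `L` gives a splitting Gibbs measure, with `exp h = L ^ k` at all vertices. -/
theorem isSplittingGibbsFor_of_isBoundaryLaw (hL : IsBoundaryLaw (boltzmannKernel J β ξ) k L A)
    (hM : M * A⁻¹ * ∫⁻ t, L t ^ (k + 1) = 1)
    (hh : ∀ x, Measurable (h x)) (hhL : ∀ x t, boundaryFactor h x t = L t ^ k)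
    {μ : Measure (V → Spin)}
    (hμ : ∀ S : Finset V, T.graph.WalkConnectedOn (S : Set V) → S.Nonempty →
      HasDensityOn volume μ S (T.graph.splittingDensity (boltzmannKernel J β ξ) L A M S)) :
    T.IsSplittingGibbsFor x₀ J β ξ h μ := by
  classical
  have hK := hL.measurable_kernel
  have hf : boundaryFactor h = fun (_ : V) t => L t ^ k := funext fun x => funext (hhL x)
  have hA0 : A⁻¹ ≠ 0 := ENNReal.inv_ne_zero.2 hL.ne_top
  have hAtop : A⁻¹ ≠ ∞ := ENNReal.inv_ne_top.2 hL.ne_zero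
  have hZ : ∀ m, (T.partitionFunction x₀ J β ξ h (m + 1))⁻¹ =
      M * A⁻¹ ^ (T.ball x₀ (m + 1)).toFinset.card := by
    intro m
    have h1 := lintegral_splittingDensity T.ncard_neighborSet T.isTree hL hM
      (T.walkConnectedOn_ball (x₀ := x₀) (m + 1)) (T.nonempty_ball (m + 1))
    simp only [splittingDensity_ball] at h1
    rw [lintegral_const_mul _ (T.measurable_ballWeight hK fun _ _ => hL.measurable.pow_const k)]
      at h1
    rw [T.partitionFunction_eq hK fun x _ => hh x, hf]
    exact (ENNReal.eq_inv_of_mul_eq_one_left h1).symm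
  have hdens : ∀ m, HasDensityOn volume μ (T.ball x₀ (m + 1))
      (fun σ => (T.partitionFunction x₀ J β ξ h (m + 1))⁻¹ *
        T.ballWeight x₀ (boltzmannKernel J β ξ) (boundaryFactor h) (m + 1) σ) := by
    intro m
    have h1 := hμ _ (T.walkConnectedOn_ball (x₀ := x₀) (m + 1)) (T.nonempty_ball (m + 1))
    rw [Set.coe_toFinset] at h1
    simp only [hZ, hf, ← splittingDensity_ball]
    exact h1
  refine ⟨fun x _ => hh x, ?_, ?_, ?_⟩
  · rintro (_ | m) hm
    · exact absurd hm (by norm_num)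
    · rw [← ENNReal.inv_ne_zero, hZ]
      exact mul_ne_zero (by rintro rfl; simp at hM) (pow_ne_zero _ hA0)
  · rintro (_ | m) hm τ
    · exact absurd hm (by norm_num)
    · obtain ⟨σ, rfl⟩ := exists_extension _ τ
      rw [T.lintegral_density_concat hK (A := fun _ => A) (L := L) (fun x _ => hh x) fun y _ s => by
        simp only [hhL]; exact hL.lintegral_eq s, density_eq, hf, hZ, hZ, Finset.prod_const,
        T.card_ball_succ x₀ (m + 1), pow_add, mul_assoc M, mul_assoc (A⁻¹ ^ _), ← mul_pow,
        ENNReal.inv_mul_cancel hL.ne_zero hL.ne_top, one_pow, mul_one]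
  · rintro (_ | m) hm
    · exact absurd hm (by norm_num)
    · exact (T.hasDensityOn_iff_marginal hK fun x _ => hh x).1 (hdens m)

/-- Normalisation fixes the constants, so a measure is determined by its boundary factors. -/
theorem eq_of_hasDensityOn_ballWeight {f : V → Spin → ℝ≥0∞} {μ μ' : Measure (V → Spin)}
    [IsProbabilityMeasure μ] [IsProbabilityMeasure μ']
    (hK : Measurable (Function.uncurry K.1)) (hf : ∀ x, Measurable (f x))
    (hμ : ∀ m, ∃ C, HasDensityOn volume μ (T.ball x₀ (m + 1))
      fun σ => C * T.ballWeight x₀ K f (m + 1) σ)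
    (hμ' : ∀ m, ∃ C, HasDensityOn volume μ' (T.ball x₀ (m + 1))
      fun σ => C * T.ballWeight x₀ K f (m + 1) σ) : μ = μ' := by
  have hC : ∀ (μ : Measure (V → Spin)) (m : ℕ) (C : ℝ≥0∞), IsProbabilityMeasure μ →
      HasDensityOn volume μ (T.ball x₀ (m + 1)) (fun σ => C * T.ballWeight x₀ K f (m + 1) σ) →
      C = (∫⁻ σ, T.ballWeight x₀ K f (m + 1) σ ∂(refMeasure V))⁻¹ := by
    intro μ m C _ h1
    have h2 := h1 (fun _ => 1) measurable_const fun _ _ _ => rfl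
    simp only [lintegral_one, measure_univ, one_mul] at h2
    rw [lintegral_const_mul _ (T.measurable_ballWeight hK fun x _ => hf x)] at h2
    exact ENNReal.eq_inv_of_mul_eq_one_left h2.symm
  refine HasDensityOn.ext (ν := volume) (S := fun m => T.ball x₀ (m + 1))
    (D := fun m σ => (∫⁻ σ, T.ballWeight x₀ K f (m + 1) σ ∂(refMeasure V))⁻¹ *
      T.ballWeight x₀ K f (m + 1) σ) ?_ ?_ ?_
  · intro I
    obtain ⟨m, hm⟩ := T.exists_subset_ball (x₀ := x₀) I
    exact ⟨m, hm.trans fun x hx => Nat.le_succ_of_le hx⟩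
  · intro m
    obtain ⟨C, hCm⟩ := hμ m
    rwa [hC μ m C inferInstance hCm] at hCm
  · intro m
    obtain ⟨C, hCm⟩ := hμ' m
    rwa [hC μ' m C inferInstance hCm] at hCm

end CayleyTree

/-! ### The kernel of the model -/

/-- The kernel `1 + θ ((t - 1/2) (u - 1/2))^{1/(2n+1)}`. -/
noncomputable def modelKernel (n : ℕ) (θ : ℝ) : SymmKernel :=
  ⟨fun t u => ENNReal.ofReal (1 + θ * spinRoot n t * spinRoot n u), fun _ _ =>
    congrArg (fun r => ENNReal.ofReal (1 + r)) (mul_right_comm θ _ _)⟩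

theorem measurable_modelKernel (n : ℕ) (θ : ℝ) :
    Measurable (Function.uncurry (modelKernel n θ).1) := by
  have h := measurable_spinRoot n
  change Measurable fun z : Spin × Spin => ENNReal.ofReal (1 + θ * spinRoot n z.1 * spinRoot n z.2)
  exact ((((h.comp measurable_fst).const_mul θ).mul
    (h.comp measurable_snd)).const_add 1).ennreal_ofReal

theorem measurable_symmKernel_comp {K : SymmKernel} (hK : Measurable (Function.uncurry K.1))
    {α : Type*} [MeasurableSpace α] {f g : α → Spin} (hf : Measurable f) (hg : Measurable g) :
    Measurable fun a => K.1 (f a) (g a) :=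
  hK.comp (hf.prodMk hg)

section Model

variable {n s : ℕ} {J β θ : ℝ}

theorem kernel_pos (hθ : |θ| < (4 : ℝ) ^ (1 / (2 * n + 1) : ℝ)) (t u : Spin) :
    0 < 1 + θ * spinRoot n t * spinRoot n u :=
  one_add_mul_spinRoot_pos (abs_mul_spinRoot_lt hθ t) u

theorem modelKernel_ne_zero (hθ : |θ| < (4 : ℝ) ^ (1 / (2 * n + 1) : ℝ)) (t u : Spin) :
    (modelKernel n θ).1 t u ≠ 0 :=
  (ENNReal.ofReal_pos.2 (kernel_pos hθ t u)).ne'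

/-- The kernel is bounded away from zero. -/
theorem exists_le_modelKernel (hθ : |θ| < (4 : ℝ) ^ (1 / (2 * n + 1) : ℝ)) :
    ∃ δ : ℝ, 0 < δ ∧ ∀ t u, ENNReal.ofReal δ ≤ (modelKernel n θ).1 t u := by
  set c := (1 / 2 : ℝ) ^ (1 / (2 * n + 1) : ℝ) with hc
  have hcy : c * (2 : ℝ) ^ (1 / (2 * n + 1) : ℝ) = 1 := half_rpow_mul_two_rpow _
  have h4 : (4 : ℝ) ^ (1 / (2 * n + 1) : ℝ) * (c * c) = 1 := by
    rw [← two_rpow_mul_self]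
    linear_combination (c * (2 : ℝ) ^ (1 / (2 * n + 1) : ℝ) + 1) * hcy
  have hc0 : 0 < c := by positivity
  refine ⟨1 - |θ| * (c * c), ?_, fun t u => ENNReal.ofReal_le_ofReal ?_⟩
  · nlinarith [mul_lt_mul_of_pos_right hθ (mul_pos hc0 hc0)]
  · have h : |θ * spinRoot n t * spinRoot n u| ≤ |θ| * (c * c) := by
      rw [abs_mul, abs_mul, mul_assoc]
      gcongr
      · exact abs_spinRoot_le n t
      · exact abs_spinRoot_le n u
    linarith [(abs_le.1 h).1]

theorem boltzmannKernel_interaction (hJ : J ≠ 0) (hβ : 0 < β)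
    (hθ : |θ| < (4 : ℝ) ^ (1 / (2 * n + 1) : ℝ)) :
    CayleyTree.boltzmannKernel J β (interaction n J β θ) = modelKernel n θ := by
  refine Subtype.ext (funext fun t => funext fun u => ?_)
  change ENNReal.ofReal (Real.exp (J * β * (1 / (J * β) * Real.log
    (1 + θ * oddRoot n (((t : ℝ) - 1 / 2) * ((u : ℝ) - 1 / 2)))))) =
      ENNReal.ofReal (1 + θ * spinRoot n t * spinRoot n u)
  have hJβ : J * β ≠ 0 := mul_ne_zero hJ hβ.ne'
  rw [← mul_assoc, mul_one_div_cancel hJβ, one_mul, oddRoot_mul, ← mul_assoc, Real.exp_log]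
  · rfl
  · exact kernel_pos hθ t u

/-- A positive density with mean `c` of the odd root sends the message `1 + θ c ρ`. -/
theorem lintegral_modelKernel_mul (hθ : |θ| < (4 : ℝ) ^ (1 / (2 * n + 1) : ℝ)) {f : Spin → ℝ}
    {c : ℝ} (hf : Integrable f) (hf0 : ∀ t, 0 < f t)
    (hc : c * ∫ t, f t = ∫ t, spinRoot n t * f t) (u : Spin) :
    ∫⁻ t, (modelKernel n θ).1 u t * ENNReal.ofReal (f t) =
      ENNReal.ofReal (∫ t, f t) * ENNReal.ofReal (1 + θ * c * spinRoot n u) := by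
  have hρf : Integrable fun t => spinRoot n t * f t :=
    hf.bdd_mul (c := 1) (measurable_spinRoot n).aestronglyMeasurable
      (Filter.Eventually.of_forall fun t => abs_spinRoot_le_one n t)
  have h1 : ∀ t, (modelKernel n θ).1 u t * ENNReal.ofReal (f t) =
      ENNReal.ofReal (f t + θ * spinRoot n u * (spinRoot n t * f t)) := by
    intro t
    change ENNReal.ofReal _ * _ = _
    rw [← ENNReal.ofReal_mul (kernel_pos hθ u t).le]
    congr 1
    ring
  have hi : Integrable fun t => f t + θ * spinRoot n u * (spinRoot n t * f t) :=
    hf.add (hρf.const_mul _)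
  simp only [h1]
  rw [← ofReal_integral_eq_lintegral_ofReal hi, integral_add hf (hρf.const_mul _),
    integral_const_mul,
    ← hc,
    ← ENNReal.ofReal_mul (integral_nonneg fun t => (hf0 t).le)]
  · congr 1
    ring
  · refine Filter.Eventually.of_forall fun t => ?_
    have := mul_pos (kernel_pos hθ u t) (hf0 t)
    simp only [Pi.zero_apply]
    linarith

theorem integral_pos_of_pos {f : Spin → ℝ} (hf : Integrable f) (hf0 : ∀ t, 0 < f t) :
    0 < ∫ t, f t := by
  rw [integral_pos_iff_support_of_nonneg (fun t => (hf0 t).le) hf]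
  have : Function.support f = Set.univ := Set.eq_univ_of_forall fun t => (hf0 t).ne'
  rw [this, measure_univ]
  exact one_pos

theorem abs_mul_lt_of_mean (hθ : |θ| < (4 : ℝ) ^ (1 / (2 * n + 1) : ℝ)) {f : Spin → ℝ}
    {c : ℝ} (hf : Integrable f) (hf0 : ∀ t, 0 < f t)
    (hc : c * ∫ t, f t = ∫ t, spinRoot n t * f t) :
    |θ * c| < (2 : ℝ) ^ (1 / (2 * n + 1) : ℝ) := by
  set b := (1 / 2 : ℝ) ^ (1 / (2 * n + 1) : ℝ) with hb
  have hpos := integral_pos_of_pos hf hf0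
  have hρf : Integrable fun t => spinRoot n t * f t :=
    hf.bdd_mul (c := 1) (measurable_spinRoot n).aestronglyMeasurable
      (Filter.Eventually.of_forall fun t => abs_spinRoot_le_one n t)
  have h1 : |c| * ∫ t, f t ≤ b * ∫ t, f t := by
    rw [← abs_of_pos hpos, ← abs_mul, hc, abs_of_pos hpos, ← integral_const_mul]
    refine (abs_integral_le_integral_abs).trans (integral_mono hρf.abs (hf.const_mul b) fun t => ?_)
    simp only [abs_mul, abs_of_pos (hf0 t)]
    exact mul_le_mul_of_nonneg_right (abs_spinRoot_le n t) (hf0 t).le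
  have h2 : |c| ≤ b := le_of_mul_le_mul_right h1 hpos
  have hb0 : 0 < b := by positivity
  calc |θ * c| = |θ| * |c| := abs_mul _ _
    _ ≤ |θ| * b := by gcongr
    _ < (4 : ℝ) ^ (1 / (2 * n + 1) : ℝ) * b := by gcongr
    _ = (2 : ℝ) ^ (1 / (2 * n + 1) : ℝ) := by
      rw [← two_rpow_mul_self, mul_assoc, mul_comm _ b, half_rpow_mul_two_rpow, mul_one]

/-- The factor `1 + y ρ`, which a vertex with message parameter `y` sends to its parent. -/
noncomputable def linearFactor (n : ℕ) (y : ℝ) (t : Spin) : ℝ≥0∞ :=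
  ENNReal.ofReal (1 + y * spinRoot n t)

theorem measurable_linearFactor (n : ℕ) (y : ℝ) : Measurable (linearFactor n y) :=
  (((measurable_spinRoot n).const_mul y).const_add 1).ennreal_ofReal

theorem linearFactor_pow {y : ℝ} (hy : |y| < (2 : ℝ) ^ (1 / (2 * n + 1) : ℝ)) (m : ℕ) (t : Spin) :
    linearFactor n y t ^ m = ENNReal.ofReal ((1 + y * spinRoot n t) ^ m) :=
  (ENNReal.ofReal_pow (one_add_mul_spinRoot_pos hy t).le m).symm

theorem integrable_one_add_mul_spinRoot_pow (n m : ℕ) (y : ℝ) :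
    Integrable fun t : Spin => (1 + y * spinRoot n t) ^ m := by
  refine integrable_spin ((((measurable_spinRoot n).const_mul y).const_add 1).pow_const m)
    (C := (1 + |y|) ^ m) fun t => ?_
  rw [abs_pow]
  refine pow_le_pow_left₀ (abs_nonneg _) ((abs_add_le _ _).trans ?_) m
  rw [abs_one, abs_mul]
  have := mul_le_mul_of_nonneg_left (abs_spinRoot_le_one n t) (abs_nonneg y)
  linarith

theorem isBoundaryLaw_linearFactor (hθ : |θ| < (4 : ℝ) ^ (1 / (2 * n + 1) : ℝ)) {c : ℝ}
    (hc : c ∈ fixedPoints n s θ) :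
    SimpleGraph.IsBoundaryLaw (modelKernel n θ) (2 * s + 1) (linearFactor n (θ * c))
      (ENNReal.ofReal (∫ t : Spin, (1 + θ * c * spinRoot n t) ^ (2 * s + 1))) where
  measurable_kernel := measurable_modelKernel n θ
  measurable := measurable_linearFactor n _
  ne_zero := (ENNReal.ofReal_pos.2 (integral_one_add_pow_pos n s _)).ne'
  ne_top := ENNReal.ofReal_ne_top
  lintegral_eq u := by
    simp only [linearFactor_pow hc.1]
    exact lintegral_modelKernel_mul hθ (integrable_one_add_mul_spinRoot_pow n _ _)
      (fun t => pow_pos (one_add_mul_spinRoot_pos hc.1 t) _) hc.2 u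

/-! ### The mean of the odd root along an edge -/

variable {V : Type*}

/-- The expectation of `g` of the spin at `x`, after division by the kernel of the edge `p x`. -/
noncomputable def edgeMean (n : ℕ) (θ : ℝ) (μ : Measure (V → Spin)) (p x : V)
    (g : Spin → ℝ≥0∞) : ℝ≥0∞ :=
  ∫⁻ σ, g (σ x) * ((modelKernel n θ).1 (σ p) (σ x))⁻¹ ∂μ

/-- The mean of the odd root of the spin at `x`, under the law of the message from `x` to `p`. It
is read off from `μ` by dividing by the kernel of the edge. The shift by one keeps the integrand
nonnegative. -/
noncomputable def messageMean (n : ℕ) (θ : ℝ) (μ : Measure (V → Spin)) (p x : V) : ℝ :=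
  (edgeMean n θ μ p x (fun t => ENNReal.ofReal (1 + spinRoot n t)) /
    edgeMean n θ μ p x fun _ => 1).toReal - 1

namespace CayleyTree

variable {x₀ : V}

/-- Translation invariance makes the means of all messages equal, since the automorphism group is
transitive on the ordered edges. -/
theorem messageMean_eq {k : ℕ} (T : CayleyTree k V) {μ : Measure (V → Spin)}
    (hμ : T.IsTranslationInvariant μ) {p x p' x' : V} (h : T.graph.Adj p x)
    (h' : T.graph.Adj p' x') : messageMean n θ μ p x = messageMean n θ μ p' x' := by
  obtain ⟨φ, rfl, rfl⟩ := T.isTree.exists_iso_of_adj (Nat.succ_ne_zero k) T.ncard_neighborSet h h'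
  have key : ∀ g : Spin → ℝ≥0∞, Measurable g →
      edgeMean n θ μ p x g = edgeMean n θ μ (φ p) (φ x) g := by
    intro g hg
    have hK : Measurable fun σ : V → Spin => (modelKernel n θ).1 (σ p) (σ x) :=
      measurable_symmKernel_comp (measurable_modelKernel n θ) (measurable_pi_apply p)
        (measurable_pi_apply x)
    have hm : Measurable fun σ : V → Spin => g (σ x) * ((modelKernel n θ).1 (σ p) (σ x))⁻¹ :=
      (hg.comp (measurable_pi_apply x)).mul hK.inv
    have hφ : μ.map (fun (σ : V → Spin) (y : V) => σ (φ y)) = μ := hμ φ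
    calc edgeMean n θ μ p x g
        = edgeMean n θ (μ.map fun (σ : V → Spin) (y : V) => σ (φ y)) p x g := by rw [hφ]
      _ = edgeMean n θ μ (φ p) (φ x) g := lintegral_map hm (by fun_prop)
  rw [messageMean, messageMean, key _ ((measurable_spinRoot n).const_add 1).ennreal_ofReal,
    key _ measurable_const]

/-- If `f x` is the boundary factor at `x`, then the message from `x` to its parent has a density
proportional to `f x`. -/
theorem messageMean_mul_integral {k : ℕ} (T : CayleyTree k V)
    (hθ : |θ| < (4 : ℝ) ^ (1 / (2 * n + 1) : ℝ))
    {μ : Measure (V → Spin)} [IsProbabilityMeasure μ] {f : V → Spin → ℝ} {C : ℝ≥0∞} {m : ℕ}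
    (hC : C ≠ 0) (hf : ∀ y ∈ T.sphere x₀ (m + 1), Measurable (f y)) (hf0 : ∀ y t, 0 < f y t)
    (hμ : HasDensityOn volume μ (T.ball x₀ (m + 1)) fun σ =>
      C * T.ballWeight x₀ (modelKernel n θ) (fun y t => ENNReal.ofReal (f y t)) (m + 1) σ)
    {x : V} (hx : x ∈ T.sphere x₀ (m + 1)) :
    Integrable (f x) ∧ messageMean n θ μ (T.parent x₀ x) x * ∫ t, f x t =
      ∫ t, spinRoot n t * f x t := by
  obtain ⟨C', hC', h⟩ := T.exists_lintegral_eq_mul_lintegral (measurable_modelKernel n θ)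
    (modelKernel_ne_zero hθ) (fun _ _ => ENNReal.ofReal_ne_top) hC
    (fun y hy => (hf y hy).ennreal_ofReal) (fun y _ t => (ENNReal.ofReal_pos.2 (hf0 y t)).ne') hμ hx
  have hone := h (fun _ => 1) measurable_const
  simp only [one_mul] at hone
  have hfin : C' * ∫⁻ t, ENNReal.ofReal (f x t) ≠ ∞ := by
    obtain ⟨δ, hδ, hδK⟩ := exists_le_modelKernel hθ
    rw [← hone]
    refine ne_top_of_le_ne_top (b := ∫⁻ _, (ENNReal.ofReal δ)⁻¹ ∂μ) ?_
      (lintegral_mono fun σ => ENNReal.inv_le_inv.2 (hδK _ _))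
    rw [lintegral_const, measure_univ, mul_one]
    exact ENNReal.inv_ne_top.2 (ENNReal.ofReal_pos.2 hδ).ne'
  have hfx0 : ∀ t, 0 ≤ f x t := fun t => (hf0 x t).le
  have hffin : ∫⁻ t, ENNReal.ofReal (f x t) ≠ ∞ := fun htop => hfin (by
    rw [htop, ENNReal.mul_top hC'])
  have hint : Integrable (f x) :=
    (lintegral_ofReal_ne_top_iff_integrable (hf x hx).aestronglyMeasurable
      (Filter.Eventually.of_forall hfx0)).1 hffin
  refine ⟨hint, ?_⟩
  have hpos := integral_pos_of_pos hint (hf0 x)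
  have hof : ∫⁻ t, ENNReal.ofReal (f x t) = ENNReal.ofReal (∫ t, f x t) :=
    (ofReal_integral_eq_lintegral_ofReal hint (Filter.Eventually.of_forall hfx0)).symm
  have hne : ∫⁻ t, ENNReal.ofReal (f x t) ≠ 0 := by
    rw [hof]
    exact (ENNReal.ofReal_pos.2 hpos).ne'
  have hCtop : C' ≠ ∞ := fun htop => hfin (by rw [htop, ENNReal.top_mul hne])
  have hρf : Integrable fun t => spinRoot n t * f x t :=
    hint.bdd_mul (c := 1) (measurable_spinRoot n).aestronglyMeasurable
      (Filter.Eventually.of_forall fun t => abs_spinRoot_le_one n t)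
  have hnn : ∀ t, 0 ≤ 1 + spinRoot n t := fun t => by
    linarith [(abs_le.1 (abs_spinRoot_le_one n t)).1]
  have hnum : ∫⁻ t, ENNReal.ofReal (1 + spinRoot n t) * ENNReal.ofReal (f x t) =
      ENNReal.ofReal ((∫ t, f x t) + ∫ t, spinRoot n t * f x t) := by
    have hi : Integrable fun t => f x t + spinRoot n t * f x t := hint.add hρf
    rw [← integral_add hint hρf, ofReal_integral_eq_lintegral_ofReal hi]
    · refine lintegral_congr fun t => ?_
      rw [← ENNReal.ofReal_mul (hnn t)]
      congr 1
      ring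
    · refine Filter.Eventually.of_forall fun t => ?_
      have := mul_nonneg (hnn t) (hfx0 t)
      simp only [Pi.zero_apply]
      linarith
  have hsum : 0 ≤ (∫ t, f x t) + ∫ t, spinRoot n t * f x t := by
    rw [← integral_add hint hρf]
    refine integral_nonneg fun t => ?_
    have := mul_nonneg (hnn t) (hfx0 t)
    simp only [Pi.zero_apply]
    linarith
  have hmean : messageMean n θ μ (T.parent x₀ x) x =
      ((∫ t, f x t) + ∫ t, spinRoot n t * f x t) / (∫ t, f x t) - 1 := by
    rw [messageMean, edgeMean, edgeMean,
      h _ ((measurable_spinRoot n).const_add 1).ennreal_ofReal, hnum]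
    simp only [one_mul]
    rw [hone, hof, ENNReal.mul_div_mul_left _ _ hC' hCtop, ENNReal.toReal_div,
      ENNReal.toReal_ofReal hsum, ENNReal.toReal_ofReal hpos.le]
  rw [hmean]
  field_simp
  ring

/-! ### Translation-invariant Gibbs measures and fixed points -/

variable (T : CayleyTree (2 * s + 1) V)

theorem mem_sphere_one {a : V} (ha : T.graph.Adj x₀ a) : a ∈ T.sphere x₀ (0 + 1) :=
  (SimpleGraph.dist_eq_one_iff_adj).2 ha

theorem parent_eq_root {a : V} (ha : T.graph.Adj x₀ a) : T.parent x₀ a = x₀ :=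
  (T.eq_parent ha.ne' ha (by simp)).symm

/-- A translation-invariant Gibbs measure has the fixed point `messageMean` as parameter: all
messages have this mean, and integrating out one more sphere turns the boundary factors into powers
of `1 + θ c ρ`. -/
theorem messageMean_mem_fixedPoints (hJ : J ≠ 0) (hβ : 0 < β)
    (hθ : |θ| < (4 : ℝ) ^ (1 / (2 * n + 1) : ℝ)) {a : V} (ha : T.graph.Adj x₀ a)
    {μ : Measure (V → Spin)}
    (hμ : μ ∈ T.translationInvariantGibbs x₀ J β (interaction n J β θ)) :
    messageMean n θ μ x₀ a ∈ fixedPoints n s θ ∧ ∀ m, ∃ C, HasDensityOn volume μ (T.ball x₀ (m + 1))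
      fun σ => C * T.ballWeight x₀ (modelKernel n θ)
        (fun _ t => linearFactor n (θ * messageMean n θ μ x₀ a) t ^ (2 * s + 1)) (m + 1) σ := by
  obtain ⟨hprob, ⟨h, hh⟩, hTI⟩ := hμ
  set c := messageMean n θ μ x₀ a with hc
  have hker := boltzmannKernel_interaction (n := n) hJ hβ hθ
  have hK : Measurable (Function.uncurry (boltzmannKernel J β (interaction n J β θ)).1) := by
    rw [hker]
    exact measurable_modelKernel n θ
  have hmeas : ∀ {m : ℕ}, ∀ x ∈ T.sphere x₀ (m + 1), Measurable (h x) := fun x hx =>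
    hh.measurable x (T.ne_root_of_mem_sphere hx)
  have hmean : ∀ {m : ℕ}, ∀ y ∈ T.sphere x₀ (m + 1), Integrable (fun t => Real.exp (h y t)) ∧
      c * ∫ t, Real.exp (h y t) = ∫ t, spinRoot n t * Real.exp (h y t) := by
    intro m y hy
    have hd := (T.hasDensityOn_iff_marginal hK hmeas).2 (hh.marginal (m + 1) (by omega))
    rw [hker] at hd
    have hy0 := T.ne_root_of_mem_sphere hy
    rw [hc, T.messageMean_eq hTI ha (T.adj_parent hy0)]
    exact T.messageMean_mul_integral hθ (f := fun y t => Real.exp (h y t))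
      (ENNReal.inv_ne_zero.2 (hh.partitionFunction_ne_top (m + 1) (by omega)))
      (fun x hx => Real.measurable_exp.comp (hmeas x hx)) (fun _ _ => Real.exp_pos _) hd hy
  have hy : |θ * c| < (2 : ℝ) ^ (1 / (2 * n + 1) : ℝ) := by
    obtain ⟨h1, h2⟩ := hmean a (T.mem_sphere_one ha)
    exact abs_mul_lt_of_mean hθ h1 (fun t => Real.exp_pos _) h2
  have hdens : ∀ m, ∃ C, C ≠ 0 ∧ HasDensityOn volume μ (T.ball x₀ (m + 1))
      fun σ => C * T.ballWeight x₀ (modelKernel n θ)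
        (fun _ t => linearFactor n (θ * c) t ^ (2 * s + 1)) (m + 1) σ := by
    intro m
    have hd := (T.hasDensityOn_iff_marginal hK hmeas).2 (hh.marginal (m + 1) (by omega))
    refine ⟨(T.partitionFunction x₀ J β (interaction n J β θ) h (m + 2))⁻¹ *
      ∏ y ∈ (T.sphere x₀ (m + 2)).toFinset, ENNReal.ofReal (∫ t, Real.exp (h y t)), ?_, ?_⟩
    · refine mul_ne_zero (ENNReal.inv_ne_zero.2 (hh.partitionFunction_ne_top (m + 2) (by omega)))
        (Finset.prod_ne_zero_iff.2 fun y hy => ?_)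
      have h1 := (hmean (m := m + 1) y (Set.mem_toFinset.1 hy)).1
      exact (ENNReal.ofReal_pos.2 (integral_pos_of_pos h1 fun t => Real.exp_pos _)).ne'
    · have hcomp : ∀ σ : V → Spin, (T.partitionFunction x₀ J β (interaction n J β θ) h (m + 1))⁻¹ *
          T.ballWeight x₀ (boltzmannKernel J β (interaction n J β θ)) (boundaryFactor h) (m + 1) σ =
          (T.partitionFunction x₀ J β (interaction n J β θ) h (m + 2))⁻¹ *
            (∏ y ∈ (T.sphere x₀ (m + 2)).toFinset, ENNReal.ofReal (∫ t, Real.exp (h y t))) *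
            T.ballWeight x₀ (boltzmannKernel J β (interaction n J β θ))
              (fun _ t => linearFactor n (θ * c) t ^ (2 * s + 1)) (m + 1) σ := fun σ => by
        rw [← density_eq, ← hh.compatible (m + 1) (by omega)]
        exact T.lintegral_density_concat hK (L := linearFactor n (θ * c))
          (A := fun y => ENNReal.ofReal (∫ t, Real.exp (h y t))) hmeas
          (fun y hy u => by
            rw [hker]
            obtain ⟨h1, h2⟩ := hmean (m := m + 1) y hy
            exact lintegral_modelKernel_mul hθ h1 (fun t => Real.exp_pos _) h2 u) σ
      rw [funext hcomp, hker] at hd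
      exact hd
  refine ⟨⟨hy, ?_⟩, fun m => ?_⟩
  · obtain ⟨C, hC, hd⟩ := hdens 0
    simp only [linearFactor_pow hy] at hd
    have h1 := (T.messageMean_mul_integral hθ
      (f := fun _ t => (1 + θ * c * spinRoot n t) ^ (2 * s + 1)) hC
      (fun _ _ => (((measurable_spinRoot n).const_mul _).const_add 1).pow_const _)
      (fun _ t => pow_pos (one_add_mul_spinRoot_pos hy t) _) hd (T.mem_sphere_one ha)).2
    rwa [T.parent_eq_root ha] at h1
  · obtain ⟨C, -, hd⟩ := hdens m
    exact ⟨C, hd⟩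

theorem exists_mem_translationInvariantGibbs (hJ : J ≠ 0) (hβ : 0 < β)
    (hθ : |θ| < (4 : ℝ) ^ (1 / (2 * n + 1) : ℝ)) {a : V} (ha : T.graph.Adj x₀ a) {c : ℝ}
    (hc : c ∈ fixedPoints n s θ) :
    ∃ μ ∈ T.translationInvariantGibbs x₀ J β (interaction n J β θ),
      messageMean n θ μ x₀ a = c := by
  have hlaw := isBoundaryLaw_linearFactor hθ hc
  set L := linearFactor n (θ * c) with hL
  set A := ENNReal.ofReal (∫ t : Spin, (1 + θ * c * spinRoot n t) ^ (2 * s + 1)) with hA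
  have hint := integrable_one_add_mul_spinRoot_pow n (2 * s + 1 + 1) (θ * c)
  have hpos := fun t => pow_pos (one_add_mul_spinRoot_pos hc.1 t) (2 * s + 1 + 1)
  have hB : ∫⁻ t, L t ^ (2 * s + 1 + 1) =
      ENNReal.ofReal (∫ t : Spin, (1 + θ * c * spinRoot n t) ^ (2 * s + 1 + 1)) := by
    simp only [hL, linearFactor_pow hc.1]
    exact (ofReal_integral_eq_lintegral_ofReal hint
      (Filter.Eventually.of_forall fun t => (hpos t).le)).symm
  set B := ∫⁻ t, L t ^ (2 * s + 1 + 1) with hBdef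
  have hB0 : B ≠ 0 := by
    rw [hB]
    exact (ENNReal.ofReal_pos.2 (integral_pos_of_pos hint hpos)).ne'
  have hBtop : B ≠ ∞ := by
    rw [hB]
    exact ENNReal.ofReal_ne_top
  have hM : A * B⁻¹ * A⁻¹ * ∫⁻ t, L t ^ (2 * s + 1 + 1) = 1 := by
    rw [← hBdef, mul_right_comm A, ENNReal.mul_inv_cancel hlaw.ne_zero hlaw.ne_top, one_mul,
      ENNReal.inv_mul_cancel hB0 hBtop]
  obtain ⟨μ, hprob, hμ⟩ := T.exists_hasDensityOn_splittingDensity x₀ hlaw hM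
  have hker := boltzmannKernel_interaction (n := n) hJ hβ hθ
  refine ⟨μ, ⟨hprob, ⟨fun _ t => Real.log ((1 + θ * c * spinRoot n t) ^ (2 * s + 1)), ?_⟩,
    T.isTranslationInvariant_of_hasDensityOn x₀ hlaw hμ⟩, ?_⟩
  · have hlog : Measurable fun t : Spin => Real.log ((1 + θ * c * spinRoot n t) ^ (2 * s + 1)) :=
      Real.measurable_log.comp ((((measurable_spinRoot n).const_mul _).const_add 1).pow_const _)
    refine T.isSplittingGibbsFor_of_isBoundaryLaw (L := L) (A := A) (M := A * B⁻¹)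
      (by rw [hker]; exact hlaw) hM
      (fun _ => hlog) (fun _ t => ?_)
      (by rw [hker]; exact hμ)
    rw [boundaryFactor, Real.exp_log (pow_pos (one_add_mul_spinRoot_pos hc.1 t) _), hL,
      linearFactor_pow hc.1]
  · have hd := hμ _ (T.walkConnectedOn_ball (x₀ := x₀) 1) (T.nonempty_ball 1)
    rw [Set.coe_toFinset] at hd
    have hd' : HasDensityOn volume μ (T.ball x₀ (0 + 1)) fun σ =>
        A * B⁻¹ * A⁻¹ ^ (T.ball x₀ (0 + 1)).toFinset.card * T.ballWeight x₀ (modelKernel n θ)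
          (fun _ t => ENNReal.ofReal ((1 + θ * c * spinRoot n t) ^ (2 * s + 1))) (0 + 1) σ := by
      simp only [← linearFactor_pow hc.1, ← hL, ← splittingDensity_ball]
      exact hd
    have hC : A * B⁻¹ * A⁻¹ ^ (T.ball x₀ (0 + 1)).toFinset.card ≠ 0 :=
      mul_ne_zero (mul_ne_zero hlaw.ne_zero (ENNReal.inv_ne_zero.2 hBtop))
        (pow_ne_zero _ (ENNReal.inv_ne_zero.2 hlaw.ne_top))
    have h1 := (T.messageMean_mul_integral hθ hC
      (f := fun _ t => (1 + θ * c * spinRoot n t) ^ (2 * s + 1))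
      (fun _ _ => (((measurable_spinRoot n).const_mul _).const_add 1).pow_const _)
      (fun _ t => pow_pos (one_add_mul_spinRoot_pos hc.1 t) _) hd' (T.mem_sphere_one ha)).2
    rw [T.parent_eq_root ha, ← hc.2] at h1
    exact mul_right_cancel₀ (integral_one_add_pow_pos n s _).ne' h1

theorem ncard_translationInvariantGibbs (x₀ : V) (hJ : J ≠ 0) (hβ : 0 < β)
    (hθ : |θ| < (4 : ℝ) ^ (1 / (2 * n + 1) : ℝ)) :
    (T.translationInvariantGibbs x₀ J β (interaction n J β θ)).ncard =
      (fixedPoints n s θ).ncard := by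
  obtain ⟨a, ha⟩ : (T.graph.neighborSet x₀).Nonempty :=
    Set.nonempty_of_ncard_ne_zero (by rw [T.ncard_neighborSet]; omega)
  refine Set.ncard_congr (fun μ _ => messageMean n θ μ x₀ a)
    (fun μ hμ => (T.messageMean_mem_fixedPoints hJ hβ hθ ha hμ).1) ?_ ?_
  · intro μ μ' hμ hμ' heq
    have := hμ.1
    have := hμ'.1
    have h1 := (T.messageMean_mem_fixedPoints hJ hβ hθ ha hμ).2
    have h2 := (T.messageMean_mem_fixedPoints hJ hβ hθ ha hμ').2
    rw [heq] at h1
    exact T.eq_of_hasDensityOn_ballWeight (measurable_modelKernel n θ)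
      (fun _ => (measurable_linearFactor n _).pow_const _) h1 h2
  · intro c hc
    obtain ⟨μ, hμ, hμc⟩ := T.exists_mem_translationInvariantGibbs hJ hβ hθ ha hc
    exact ⟨μ, hμ, hμc⟩

end CayleyTree

end Model

theorem theorem3p10 {V : Type*} (n s : ℕ) (hs : 1 ≤ s) (T : CayleyTree (2 * s + 1) V) (x₀ : V)
    (J β θ : ℝ) (hJ : J ≠ 0) (hβ : 0 < β)
    (hθ : -(4 : ℝ) ^ (1 / (2 * n + 1) : ℝ) < θ) (hθ' : θ < (4 : ℝ) ^ (1 / (2 * n + 1) : ℝ)) :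
    ((θ ≤ thetaOdd n s 0 ∨ thetaOdd n s s ≤ θ) →
      (T.translationInvariantGibbs x₀ J β (interaction n J β θ)).ncard = 1) ∧
    (thetaAverage n s ≤ θ ∧ θ < thetaOdd n s s →
      (T.translationInvariantGibbs x₀ J β (interaction n J β θ)).ncard = 2) ∧
    (thetaOdd n s 0 < θ ∧ θ < thetaAverage n s →
      (T.translationInvariantGibbs x₀ J β (interaction n J β θ)).ncard = 3) := by
  rw [T.ncard_translationInvariantGibbs x₀ hJ hβ (abs_lt.2 ⟨hθ, hθ'⟩)]
  refine ⟨?_, fun h => ?_, fun h => ncard_fixedPoints_eq_three h.1 h.2⟩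
  · rintro (h | h)
    · rw [fixedPoints_eq_zero hs h, Set.ncard_singleton]
    · -- no `θ` of the model lies in this range
      exact absurd (four_rpow_lt_thetaOdd_last.trans_le h) hθ'.not_gt
  · -- nor in this one, since `θ̄` is at least `4^{1/(2n+1)}`
    exact absurd ((four_rpow_le_thetaAverage n s).trans h.1) hθ'.not_ge
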